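/- **Theorem (Sharp threshold for the symmetric spherical perceptron).** There is a universal constant $C>0$ such that the following holds. Let $q\in[2,\infty]$, $\alpha\in(0,\infty)$, let $N\ge 1$ be an integer, and let $M\ge 0$ be an integer with $|M-\alpha N|<1$ (so $M=\alpha N$ if $\alpha N$ is an integer, and otherwise $M$ is $\alpha N$ rounded down or up). Let $A$ be an $M\times N$ random matrix whose entries are independent standard normal random variables. Let $S^{N-1}=\{\sigma\in\mathbb R^N:\|\sigma\|_2=1\}$, let $\|v\|_q=\bigl(\sum_{i}|v_i|^q\bigr)^{1/q}$ for $q<\infty$, and let $\|v\|_\infty=\max_{i}|v_i|$ (the norm on $\mathbb R^0$ being $0$). Then $\min_{\sigma\in S^{N-1}}\|A\sigma\|_q$ has a finite second moment and $$\operatorname{Var}\Bigl(\min_{\sigma\in S^{N-1}}\|A\sigma\|_q\Bigr)\;\le\;\frac{C}{1+\bigl(\tfrac12-\tfrac1q\bigr)\log N},$$ where $1/q=0$ if $q=\infty$. -/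

import Mathlib

open MeasureTheory ProbabilityTheory
open scoped ENNReal NNReal

/-- The `ℓ^q` norm (`q ∈ [1, ∞]`) of a vector in `ℝ^M`. -/
noncomputable def lqNorm (q : ℝ≥0∞) {M : ℕ} (v : Fin M → ℝ) : ℝ :=
  ‖(WithLp.toLp q v : PiLp q (fun _ : Fin M => ℝ))‖

/-- The `ℓ^q` norm is the usual `(∑ |v_i|^q)^(1/q)` for finite exponents. -/
theorem lqNorm_of_ne_top {q : ℝ≥0∞} (hq : 1 ≤ q) (hq' : q ≠ ∞) {M : ℕ} (v : Fin M → ℝ) :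
    lqNorm q v = (∑ i, |v i| ^ q.toReal) ^ (1 / q.toReal) := by
  have h : 0 < q.toReal := ENNReal.toReal_pos (by positivity) hq'
  simp [lqNorm, PiLp.norm_eq_sum h]

/-- The `ℓ^∞` norm is the maximum of the absolute values of the coordinates. -/
theorem lqNorm_top {M : ℕ} (v : Fin M → ℝ) : lqNorm ∞ v = ⨆ i, |v i| := by
  simp [lqNorm, PiLp.norm_eq_ciSup]

/-- The values `‖A σ‖_q`, where `σ` ranges over the Euclidean unit sphere `S^{N-1} ⊆ ℝ^N`. -/
def sphereValues (q : ℝ≥0∞) {M N : ℕ} (A : Matrix (Fin M) (Fin N) ℝ) : Set ℝ :=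
  (fun σ : EuclideanSpace ℝ (Fin N) => lqNorm q (A.mulVec σ.ofLp)) '' Metric.sphere 0 1

/-- `min_{σ ∈ S^{N-1}} ‖A σ‖_q`. It is an attained minimum: see `isLeast_minSphere`. -/
noncomputable def minSphere (q : ℝ≥0∞) {M N : ℕ} (A : Matrix (Fin M) (Fin N) ℝ) : ℝ :=
  sInf (sphereValues q A)

/-- The infimum in `minSphere` is a minimum. -/
theorem isLeast_minSphere {q : ℝ≥0∞} (hq : 1 ≤ q) {M N : ℕ} (hN : 1 ≤ N)
    (A : Matrix (Fin M) (Fin N) ℝ) : IsLeast (sphereValues q A) (minSphere q A) := by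
  haveI : Fact (1 ≤ q) := ⟨hq⟩
  haveI : Nonempty (Fin N) := ⟨⟨0, hN⟩⟩
  have hcont : Continuous
      (fun σ : EuclideanSpace ℝ (Fin N) => lqNorm q (A.mulVec σ.ofLp)) := by
    unfold lqNorm
    have h1 : Continuous (fun σ : EuclideanSpace ℝ (Fin N) => A.mulVec σ.ofLp) :=
      Continuous.matrix_mulVec continuous_const (PiLp.continuous_ofLp 2 _)
    exact ((PiLp.continuous_toLp q _).comp h1).norm
  have hne : (Metric.sphere (0 : EuclideanSpace ℝ (Fin N)) 1).Nonempty :=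
    NormedSpace.sphere_nonempty.mpr zero_le_one
  exact ((isCompact_sphere _ _).image hcont).isLeast_sInf (hne.image _)

/-! If `M < N`, the matrix has a kernel and the minimum is `0`. Otherwise this is superconcentration
forced by symmetry. As a function of the `n = MN` Gaussian entries, the minimum is `1`-Lipschitz for
the Euclidean norm (because `q ≥ 2`), `L`-Lipschitz for the maximum norm with `L = M^(1/q) √N`, and
invariant under row and column permutations, which act transitively on the entries.

Hence all partial derivatives have the same law, with second moment at most `1/n` and first absolute
moment at most `L/n`. The variance is the integral over correlations `ρ ∈ [0,1]` of `∑ k, E[∂ₖf(X)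
∂ₖf(X_ρ)]`. Hypercontractivity bounds a summand by the square of the `L^(1+ρ)` norm of `∂ₖf`, and
interpolation between `L¹` and `L²` gives `exp(-ℓ(1-ρ)/2)/n` whenever `L²/n ≤ exp(-ℓ)`. Integrating,
the variance is at most `1` and at most `2/ℓ`. Here `L²/n = M^(2/q-1)`, so `ℓ = (1-2/q) log M`.

The argument runs on the discrete cube (`noiseForm_le`, `hasDerivAt_noiseForm`, `cube_variance_le`).
It passes to Gaussian vectors by the central limit theorem (`tendsto_cubeMean_bitSum`), first for
bounded functions with Lipschitz gradient, then in general by mollifying and truncating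
(`SymmetricLipschitz.variance_le`). The geometry of the minimum enters through
`symmetricLipschitz_minSphere`. -/

/-! ### Two-point inequalities -/

theorem two_mul_le_rpow_one_add_sub_rpow_one_sub {r y : ℝ} (hr0 : 0 ≤ r) (hr1 : r ≤ 1)
    (hy0 : 0 ≤ y) (hy1 : y ≤ 1) : 2 * r * y ≤ (1 + y) ^ r - (1 - y) ^ r := by
  rcases hr0.eq_or_lt with rfl | hr
  · simp
  have hmono : MonotoneOn (fun y : ℝ => (1 + y) ^ r - (1 - y) ^ r - 2 * r * y) (Set.Icc 0 1) := by
    apply monotoneOn_of_hasDerivWithinAt_nonneg (convex_Icc 0 1)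
      (f' := fun y => 1 * r * (1 + y) ^ (r - 1) - (-1) * r * (1 - y) ^ (r - 1) - 2 * r * 1)
    · refine ContinuousOn.sub (ContinuousOn.sub ?_ ?_) (by fun_prop)
      · exact ContinuousOn.rpow_const (by fun_prop) fun x _ => Or.inr hr.le
      · exact ContinuousOn.rpow_const (by fun_prop) fun x _ => Or.inr hr.le
    · intro x hx
      rw [interior_Icc] at hx
      apply HasDerivAt.hasDerivWithinAt
      refine ((HasDerivAt.rpow_const ?_ (Or.inl ?_)).sub
        (HasDerivAt.rpow_const ?_ (Or.inl ?_))).sub ((hasDerivAt_id x).const_mul (2 * r))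
      · exact (hasDerivAt_id x).const_add 1
      · have := hx.1; positivity
      · exact (hasDerivAt_id x).const_sub 1
      · have := hx.2; linarith
    · intro x hx
      rw [interior_Icc] at hx
      have h1 : 0 < 1 + x := by linarith [hx.1]
      have h2 : 0 < 1 - x := by linarith [hx.2]
      have hu := Real.rpow_pos_of_pos h1 (r - 1)
      have hv := Real.rpow_pos_of_pos h2 (r - 1)
      -- The product is `(1 - x²)^(r-1)` with nonpositive exponent. By AM-GM the sum of the factors
      -- is then at least `2`, which makes the derivative nonnegative.
      have huv : 1 ≤ (1 + x) ^ (r - 1) * (1 - x) ^ (r - 1) := by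
        rw [← Real.mul_rpow h1.le h2.le]
        exact Real.one_le_rpow_of_pos_of_le_one_of_nonpos (by positivity)
          (by nlinarith [sq_nonneg x]) (by linarith)
      have : 2 ≤ (1 + x) ^ (r - 1) + (1 - x) ^ (r - 1) := by
        nlinarith [sq_nonneg ((1 + x) ^ (r - 1) - (1 - x) ^ (r - 1))]
      nlinarith
  have := hmono (Set.left_mem_Icc.2 zero_le_one) ⟨hy0, hy1⟩ hy0
  simp at this
  linarith

/-- The difference of the two sides vanishes at `y = 0`, and its derivative is nonnegative by the
previous inequality with `r = p - 1`. -/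
theorem one_add_mul_sq_le_rpow_add_rpow {p y : ℝ} (hp1 : 1 ≤ p) (hp2 : p ≤ 2)
    (hy0 : 0 ≤ y) (hy1 : y ≤ 1) :
    1 + p / 2 * ((p - 1) * y ^ 2) ≤ ((1 + y) ^ p + (1 - y) ^ p) / 2 := by
  have hmono : MonotoneOn (fun y : ℝ => (1 + y) ^ p + (1 - y) ^ p - p * (p - 1) * y ^ 2)
      (Set.Icc 0 1) := by
    apply monotoneOn_of_hasDerivWithinAt_nonneg (convex_Icc 0 1)
      (f' := fun y => 1 * p * (1 + y) ^ (p - 1) + (-1) * p * (1 - y) ^ (p - 1)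
        - p * (p - 1) * (2 * y))
    · refine ContinuousOn.sub (ContinuousOn.add ?_ ?_) (by fun_prop)
      · exact ContinuousOn.rpow_const (by fun_prop) fun x _ => Or.inr (by linarith)
      · exact ContinuousOn.rpow_const (by fun_prop) fun x _ => Or.inr (by linarith)
    · intro x hx
      apply HasDerivAt.hasDerivWithinAt
      refine ((HasDerivAt.rpow_const ?_ (Or.inr hp1)).add
        (HasDerivAt.rpow_const ?_ (Or.inr hp1))).sub (HasDerivAt.const_mul _ ?_)
      · exact (hasDerivAt_id x).const_add 1
      · exact (hasDerivAt_id x).const_sub 1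
      · simpa using hasDerivAt_pow 2 x
    · intro x hx
      rw [interior_Icc] at hx
      have := two_mul_le_rpow_one_add_sub_rpow_one_sub (r := p - 1) (by linarith) (by linarith)
        hx.1.le hx.2.le
      nlinarith
  have := hmono (Set.left_mem_Icc.2 zero_le_one) ⟨hy0, hy1⟩ hy0
  simp at this
  linarith

/-- The two-point inequality behind hypercontractivity. -/
theorem sq_add_mul_sq_rpow_le {ρ a b : ℝ} (h0 : 0 ≤ ρ) (h1 : ρ ≤ 1) (ha : 0 ≤ a) (hb : |b| ≤ a) :
    (a ^ 2 + ρ * b ^ 2) ^ ((1 + ρ) / 2) ≤ ((a + b) ^ (1 + ρ) + (a - b) ^ (1 + ρ)) / 2 := by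
  wlog hb0 : 0 ≤ b generalizing b
  · have := this (b := -b) (by simpa using hb) (by linarith)
    rw [neg_sq, sub_neg_eq_add, ← sub_eq_add_neg] at this
    linarith
  rw [abs_of_nonneg hb0] at hb
  rcases ha.eq_or_lt with rfl | ha
  · have : b = 0 := by linarith
    subst this
    have h : 1 + ρ ≠ 0 := by linarith
    have h' : (1 + ρ) / 2 ≠ 0 := by positivity
    simp [Real.zero_rpow h, Real.zero_rpow h']
  -- Both sides are homogeneous of degree `1 + ρ`, which reduces to `a = 1`.
  obtain ⟨y, rfl⟩ : ∃ y, b = a * y := ⟨b / a, by field_simp⟩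
  have hy0 : 0 ≤ y := nonneg_of_mul_nonneg_right hb0 ha
  have hy1 : y ≤ 1 := by nlinarith
  have e1 : a ^ 2 + ρ * (a * y) ^ 2 = a ^ 2 * (1 + ρ * y ^ 2) := by ring
  have e2 : a + a * y = a * (1 + y) := by ring
  have e3 : a - a * y = a * (1 - y) := by ring
  have e4 : (a ^ 2) ^ ((1 + ρ) / 2) = a ^ (1 + ρ) := by
    rw [← Real.rpow_natCast_mul ha.le]; congr 1; push_cast; ring
  rw [e1, e2, e3, Real.mul_rpow (by positivity) (by positivity), e4,
    Real.mul_rpow ha.le (by linarith), Real.mul_rpow ha.le (by linarith), ← mul_add, mul_div_assoc]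
  gcongr
  -- Bernoulli's inequality for the exponent `(1 + ρ)/2 ≤ 1`.
  have hb := rpow_one_add_le_one_add_mul_self (s := ρ * y ^ 2) (p := (1 + ρ) / 2)
    (by nlinarith [mul_nonneg h0 (sq_nonneg y)]) (by linarith) (by linarith)
  refine hb.trans ?_
  have := one_add_mul_sq_le_rpow_add_rpow (p := 1 + ρ) (by linarith) (by linarith) hy0 hy1
  linarith

/-- The sign attached to a bit. -/
def bitSign (b : Bool) : ℝ := if b then 1 else -1

@[simp] theorem bitSign_true : bitSign true = 1 := rfl
@[simp] theorem bitSign_false : bitSign false = -1 := by simp [bitSign]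
@[simp] theorem bitSign_not (b : Bool) : bitSign (!b) = -bitSign b := by cases b <;> simp
@[simp] theorem bitSign_mul_self (b : Bool) : bitSign b * bitSign b = 1 := by cases b <;> simp

/-- With `f = a + bε` and `g = c + dε` for a sign `ε`, the left side is `ac + ρbd`. Cauchy-Schwarz
bounds it by `√(a² + ρb²) √(c² + ρd²)`, and the preceding inequality handles each factor. -/
theorem two_point_hypercontractive {ρ : ℝ} (h0 : 0 ≤ ρ) (h1 : ρ ≤ 1) {f g : Bool → ℝ}
    (hf : ∀ b, 0 ≤ f b) (hg : ∀ b, 0 ≤ g b) :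
    ∑ a, ∑ b, (1 + ρ * (bitSign a * bitSign b)) / 4 * (f a * g b) ≤
      ((∑ a, f a ^ (1 + ρ)) / 2) ^ (1 / (1 + ρ)) * ((∑ b, g b ^ (1 + ρ)) / 2) ^ (1 / (1 + ρ)) := by
  have key : ∀ f : Bool → ℝ, (∀ b, 0 ≤ f b) →
      √(((f true + f false) / 2) ^ 2 + ρ * ((f true - f false) / 2) ^ 2) ≤
        ((∑ a, f a ^ (1 + ρ)) / 2) ^ (1 / (1 + ρ)) := by
    intro f hf
    have h := sq_add_mul_sq_rpow_le (a := (f true + f false) / 2) (b := (f true - f false) / 2)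
      h0 h1 (by linarith [hf true, hf false])
      (abs_le.2 ⟨by linarith [hf true, hf false], by linarith [hf true, hf false]⟩)
    have h' := Real.rpow_le_rpow (by positivity) h (z := 1 / (1 + ρ)) (by positivity)
    rw [← Real.rpow_mul (by positivity)] at h'
    rw [Real.sqrt_eq_rpow]
    convert h' using 2
    · field_simp
    · simp only [Fintype.univ_bool, Finset.mem_singleton, Bool.true_eq_false, not_false_eq_true,
        Finset.sum_insert, Finset.sum_singleton]
      ring_nf
  refine le_trans ?_ (mul_le_mul (key f hf) (key g hg) (Real.sqrt_nonneg _)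
    (Real.rpow_nonneg
      (div_nonneg (Finset.sum_nonneg fun b _ => Real.rpow_nonneg (hf b) _) zero_le_two) _))
  rw [← Real.sqrt_mul (by positivity)]
  apply Real.le_sqrt_of_sq_le
  simp only [Fintype.univ_bool, Finset.mem_singleton, Bool.true_eq_false, not_false_eq_true,
        Finset.sum_insert, Finset.sum_singleton, bitSign_true, bitSign_false]
  set a := (f true + f false) / 2 with ha
  set b := (f true - f false) / 2 with hb
  set c := (g true + g false) / 2 with hc
  set d := (g true - g false) / 2 with hd
  have e : f true = a + b ∧ f false = a - b ∧ g true = c + d ∧ g false = c - d := by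
    refine ⟨?_, ?_, ?_, ?_⟩ <;> simp only [ha, hb, hc, hd] <;> ring
  rw [e.1, e.2.1, e.2.2.1, e.2.2.2]
  -- `(a² + ρb²)(c² + ρd²) - (ac + ρbd)² = ρ(ad - bc)²`.
  nlinarith [mul_nonneg h0 (sq_nonneg (a * d - b * c))]

/-! ### Noise and hypercontractivity on the discrete cube -/

section Cube

variable {ι : Type*} [Fintype ι]

/-- The joint law of a pair of `ρ`-correlated uniform points of the discrete cube. -/
noncomputable def noiseKernel (ρ : ℝ) (x y : ι → Bool) : ℝ :=
  ∏ i, (1 + ρ * (bitSign (x i) * bitSign (y i))) / 4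

theorem noiseKernel_nonneg {ρ : ℝ} (h0 : 0 ≤ ρ) (h1 : ρ ≤ 1) (x y : ι → Bool) :
    0 ≤ noiseKernel ρ x y := by
  refine Finset.prod_nonneg fun i _ => div_nonneg ?_ (by norm_num)
  cases x i <;> cases y i <;> simp <;> linarith

variable [DecidableEq ι]

/-- The uniform mean over the discrete cube. -/
noncomputable def cubeMean (f : (ι → Bool) → ℝ) : ℝ := (1 / 2) ^ Fintype.card ι * ∑ x, f x

/-- `E f(X) g(Y)` for a pair of `ρ`-correlated uniform points of the discrete cube. -/
noncomputable def noiseForm (ρ : ℝ) (f g : (ι → Bool) → ℝ) : ℝ :=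
  ∑ x, ∑ y, noiseKernel ρ x y * (f x * g y)

theorem cubeMean_nonneg {f : (ι → Bool) → ℝ} (hf : ∀ x, 0 ≤ f x) : 0 ≤ cubeMean f :=
  mul_nonneg (by positivity) (Finset.sum_nonneg fun x _ => hf x)

theorem cubeMean_succ {n : ℕ} (f : (Fin (n + 1) → Bool) → ℝ) :
    cubeMean f = (∑ b, cubeMean fun x => f (Fin.cons b x)) / 2 := by
  have : ∑ x, f x = ∑ b, ∑ x, f (Fin.cons b x) := by
    rw [← Fintype.sum_prod_type']
    exact (Fintype.sum_equiv (Fin.consEquiv fun _ => Bool) _ _ fun x => rfl).symm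
  simp only [cubeMean, Fintype.card_fin, this, pow_succ, ← Finset.mul_sum]
  ring

theorem noiseForm_succ {n : ℕ} (ρ : ℝ) (f g : (Fin (n + 1) → Bool) → ℝ) :
    noiseForm ρ f g = ∑ a, ∑ b, (1 + ρ * (bitSign a * bitSign b)) / 4 *
      noiseForm ρ (fun x => f (Fin.cons a x)) (fun x => g (Fin.cons b x)) := by
  have h : ∀ f : (Fin (n + 1) → Bool) → ℝ, ∑ x, f x = ∑ b, ∑ x, f (Fin.cons b x) := by
    intro f
    rw [← Fintype.sum_prod_type']
    exact (Fintype.sum_equiv (Fin.consEquiv fun _ => Bool) _ _ fun x => rfl).symm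
  simp only [noiseForm, h, noiseKernel, Fin.prod_univ_succ, Fin.cons_zero, Fin.cons_succ,
    Finset.mul_sum]
  refine Finset.sum_congr rfl fun a _ => ?_
  rw [Finset.sum_comm]
  refine Finset.sum_congr rfl fun b _ => Finset.sum_congr rfl fun x _ =>
    Finset.sum_congr rfl fun y _ => ?_
  ring

/-- Tensorisation: the induction hypothesis bounds the form for each pair of values of the first
bits, and the two-point inequality is then applied to the `L^(1+ρ)` norms of the slices. -/
theorem noiseForm_le_fin {ρ : ℝ} (h0 : 0 ≤ ρ) (h1 : ρ ≤ 1) {n : ℕ} {f g : (Fin n → Bool) → ℝ}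
    (hf : ∀ x, 0 ≤ f x) (hg : ∀ x, 0 ≤ g x) :
    noiseForm ρ f g ≤ cubeMean (fun x => f x ^ (1 + ρ)) ^ (1 / (1 + ρ)) *
      cubeMean (fun x => g x ^ (1 + ρ)) ^ (1 / (1 + ρ)) := by
  have hp : 1 + ρ ≠ 0 := by linarith
  induction n with
  | zero =>
    simp only [noiseForm, noiseKernel, cubeMean, Finset.univ_unique, Finset.sum_singleton,
      Fintype.card_fin, pow_zero, one_mul, Finset.univ_eq_empty, Finset.prod_empty]
    rw [← Real.rpow_mul (hf _), ← Real.rpow_mul (hg _), mul_one_div_cancel hp, Real.rpow_one,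
      Real.rpow_one]
  | succ n ih =>
    rw [noiseForm_succ, cubeMean_succ, cubeMean_succ]
    have key : ∀ f : (Fin (n + 1) → Bool) → ℝ, (∀ x, 0 ≤ f x) → ∀ b,
        cubeMean (fun x => f (Fin.cons b x) ^ (1 + ρ)) =
          (cubeMean (fun x => f (Fin.cons b x) ^ (1 + ρ)) ^ (1 / (1 + ρ))) ^ (1 + ρ) := by
      intro f hf b
      rw [← Real.rpow_mul (cubeMean_nonneg fun x => Real.rpow_nonneg (hf _) _),
        one_div_mul_cancel hp, Real.rpow_one]
    rw [Finset.sum_congr rfl fun b _ => key f hf b, Finset.sum_congr rfl fun b _ => key g hg b]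
    refine le_trans ?_ (two_point_hypercontractive h0 h1
      (fun b => Real.rpow_nonneg (cubeMean_nonneg fun x => Real.rpow_nonneg (hf _) _) _)
      (fun b => Real.rpow_nonneg (cubeMean_nonneg fun x => Real.rpow_nonneg (hg _) _) _))
    refine Finset.sum_le_sum fun a _ => Finset.sum_le_sum fun b _ => ?_
    refine mul_le_mul_of_nonneg_left ?_ ?_
    · exact ih (fun x => hf _) (fun x => hg _)
    · cases a <;> cases b <;> simp <;> linarith

theorem cubeMean_arrowCongr {κ : Type*} [Fintype κ] [DecidableEq κ] (e : ι ≃ κ)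
    (f : (κ → Bool) → ℝ) :
    cubeMean (fun x : ι → Bool => f (x ∘ e.symm)) = cubeMean f := by
  simp only [cubeMean, Fintype.card_congr e]
  congr 1
  exact Fintype.sum_equiv (e.arrowCongr (Equiv.refl Bool)) _ _ fun x => rfl

theorem noiseForm_arrowCongr {κ : Type*} [Fintype κ] [DecidableEq κ] (e : ι ≃ κ)
    (ρ : ℝ) (f g : (κ → Bool) → ℝ) :
    noiseForm ρ (fun x : ι → Bool => f (x ∘ e.symm)) (fun x => g (x ∘ e.symm)) =
      noiseForm ρ f g := by
  simp only [noiseForm]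
  refine Fintype.sum_equiv (e.arrowCongr (Equiv.refl Bool)) _ _ fun x => ?_
  refine Fintype.sum_equiv (e.arrowCongr (Equiv.refl Bool)) _ _ fun y => ?_
  congr 1
  exact Fintype.prod_equiv e _ _ fun i => by simp

/-- Two-function hypercontractivity on the discrete cube. -/
theorem noiseForm_le {ρ : ℝ} (h0 : 0 ≤ ρ) (h1 : ρ ≤ 1) {f g : (ι → Bool) → ℝ}
    (hf : ∀ x, 0 ≤ f x) (hg : ∀ x, 0 ≤ g x) :
    noiseForm ρ f g ≤ cubeMean (fun x => f x ^ (1 + ρ)) ^ (1 / (1 + ρ)) *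
      cubeMean (fun x => g x ^ (1 + ρ)) ^ (1 / (1 + ρ)) := by
  have e := Fintype.equivFin ι
  rw [← noiseForm_arrowCongr e.symm, ← cubeMean_arrowCongr e.symm,
    ← cubeMean_arrowCongr e.symm (fun x => g x ^ (1 + ρ))]
  exact noiseForm_le_fin h0 h1 (fun x => hf _) (fun x => hg _)

end Cube

/-! ### Discrete derivatives and the variance bound on the cube -/

section Cube

variable {ι : Type*} [DecidableEq ι]

/-- Flip one bit. -/
def bitFlip (k : ι) (x : ι → Bool) : ι → Bool := Function.update x k (!x k)

theorem bitFlip_bitFlip (k : ι) (x : ι → Bool) : bitFlip k (bitFlip k x) = x := by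
  simp [bitFlip]

theorem bitFlip_apply_self (k : ι) (x : ι → Bool) : bitFlip k x k = !x k := by
  simp [bitFlip]

theorem bitFlip_apply_of_ne {k j : ι} (h : j ≠ k) (x : ι → Bool) : bitFlip k x j = x j := by
  simp [bitFlip, h]

/-- The discrete derivative in the direction of one bit. -/
noncomputable def bitDeriv (k : ι) (f : (ι → Bool) → ℝ) (x : ι → Bool) : ℝ :=
  bitSign (x k) * ((f x - f (bitFlip k x)) / 2)

theorem abs_bitSign (b : Bool) : |bitSign b| = 1 := by cases b <;> simp

theorem abs_bitDeriv (k : ι) (f : (ι → Bool) → ℝ) (x : ι → Bool) :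
    |bitDeriv k f x| = |f (bitFlip k x) - f x| / 2 := by
  rw [bitDeriv, abs_mul, abs_bitSign, one_mul, abs_div, abs_two, abs_sub_comm]

theorem bitDeriv_bitFlip (k : ι) (f : (ι → Bool) → ℝ) (x : ι → Bool) :
    bitDeriv k f (bitFlip k x) = bitDeriv k f x := by
  rw [bitDeriv, bitDeriv, bitFlip_bitFlip, bitFlip_apply_self, bitSign_not]
  ring

theorem bitDeriv_comp_equiv {f : (ι → Bool) → ℝ} {e : ι ≃ ι} (he : ∀ x, f (x ∘ e) = f x)
    (k : ι) (x : ι → Bool) : bitDeriv k f (x ∘ e) = bitDeriv (e k) f x := by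
  have : bitFlip k (x ∘ e) = bitFlip (e k) x ∘ e := by
    funext j
    by_cases h : j = k
    · subst h; simp [bitFlip]
    · simp [bitFlip, h]
  rw [bitDeriv, bitDeriv, this, he, he, Function.comp_apply]

variable [Fintype ι]

theorem sum_bitFlip (k : ι) (h : (ι → Bool) → ℝ) : ∑ x, h (bitFlip k x) = ∑ x, h x :=
  Fintype.sum_equiv (Function.Involutive.toPerm (bitFlip k) (bitFlip_bitFlip k)) _ _ fun _ => rfl

/-- Averaging over `x` and its flip at `k` leaves only the part of `f` that is odd in bit `k`. -/
theorem sum_mul_bitSign_mul (k : ι) {r : (ι → Bool) → ℝ} (hr : ∀ x, r (bitFlip k x) = r x)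
    (f : (ι → Bool) → ℝ) :
    ∑ x, r x * (bitSign (x k) * f x) = ∑ x, r x * bitDeriv k f x := by
  have h := sum_bitFlip k fun x => r x * (bitSign (x k) * f x)
  simp only [hr, bitFlip_apply_self, bitSign_not] at h
  have : ∑ x, r x * bitDeriv k f x = (∑ x, r x * (bitSign (x k) * f x)) / 2
      + (∑ x, r x * (-bitSign (x k) * f (bitFlip k x))) / 2 := by
    rw [Finset.sum_div, Finset.sum_div, ← Finset.sum_add_distrib]
    exact Finset.sum_congr rfl fun x _ => by rw [bitDeriv]; ring
  rw [this, h]; ring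

theorem sum_mul_bitSign_mul_bitDeriv (k : ι) {r : (ι → Bool) → ℝ}
    (hr : ∀ x, r (bitFlip k x) = r x) (f : (ι → Bool) → ℝ) :
    ∑ x, r x * (bitSign (x k) * bitDeriv k f x) = 0 := by
  have h := sum_bitFlip k fun x => r x * (bitSign (x k) * bitDeriv k f x)
  simp only [hr, bitFlip_apply_self, bitSign_not, bitDeriv_bitFlip, neg_mul, mul_neg,
    Finset.sum_neg_distrib] at h
  linarith

/-- The kernel factor at `k` is replaced by its derivative in `ρ`. The discrete derivatives do not
depend on bit `k`, so the `ρ` term of that factor averages out, and the remaining constant term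
matches the signs pulled out of `f` and `g`. -/
theorem noiseForm_bitDeriv (ρ : ℝ) (k : ι) (f g : (ι → Bool) → ℝ) :
    noiseForm ρ (bitDeriv k f) (bitDeriv k g) =
      ∑ x, ∑ y, ((∏ j ∈ Finset.univ.erase k, (1 + ρ * (bitSign (x j) * bitSign (y j))) / 4) *
        ((bitSign (x k) * bitSign (y k)) / 4)) * (f x * g y) := by
  set R : (ι → Bool) → (ι → Bool) → ℝ := fun x y =>
    ∏ j ∈ Finset.univ.erase k, (1 + ρ * (bitSign (x j) * bitSign (y j))) / 4 with hR
  have hx : ∀ x y, R (bitFlip k x) y = R x y := fun x y =>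
    Finset.prod_congr rfl fun j hj => by rw [bitFlip_apply_of_ne (Finset.ne_of_mem_erase hj)]
  have hy : ∀ x y, R x (bitFlip k y) = R x y := fun x y =>
    Finset.prod_congr rfl fun j hj => by rw [bitFlip_apply_of_ne (Finset.ne_of_mem_erase hj)]
  have hK : ∀ x y, noiseKernel ρ x y = R x y * ((1 + ρ * (bitSign (x k) * bitSign (y k))) / 4) := by
    intro x y
    rw [noiseKernel, hR, Finset.prod_erase_mul _ _ (Finset.mem_univ k)]
  have h1 : ∑ x, ∑ y, (R x y * ((bitSign (x k) * bitSign (y k)) / 4)) * (f x * g y) =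
      ∑ x, ∑ y, R x y * (bitDeriv k f x * bitDeriv k g y) / 4 := by
    calc _ = ∑ x, (bitSign (x k) * f x) / 4 * ∑ y, R x y * (bitSign (y k) * g y) := by
          simp only [Finset.mul_sum]
          exact Finset.sum_congr rfl fun x _ => Finset.sum_congr rfl fun y _ => by ring
      _ = ∑ x, (bitSign (x k) * f x) / 4 * ∑ y, R x y * bitDeriv k g y := by
          simp only [sum_mul_bitSign_mul k (hy _)]
      _ = ∑ y, bitDeriv k g y / 4 * ∑ x, R x y * (bitSign (x k) * f x) := by
          simp only [Finset.mul_sum]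
          rw [Finset.sum_comm]
          exact Finset.sum_congr rfl fun x _ => Finset.sum_congr rfl fun y _ => by ring
      _ = ∑ y, bitDeriv k g y / 4 * ∑ x, R x y * bitDeriv k f x :=
          Finset.sum_congr rfl fun y _ => by
            rw [sum_mul_bitSign_mul k (r := fun x => R x y) (fun x => hx x y)]
      _ = _ := by
          simp only [Finset.mul_sum]
          rw [Finset.sum_comm]
          exact Finset.sum_congr rfl fun x _ => Finset.sum_congr rfl fun y _ => by ring
  have h2 : ∑ x, ∑ y, R x y * (ρ * (bitSign (x k) * bitSign (y k)) / 4) *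
      (bitDeriv k f x * bitDeriv k g y) = 0 := by
    calc _ = ∑ x, (bitSign (x k) * bitDeriv k f x) * ρ / 4 *
          ∑ y, R x y * (bitSign (y k) * bitDeriv k g y) := by
          simp only [Finset.mul_sum]
          exact Finset.sum_congr rfl fun x _ => Finset.sum_congr rfl fun y _ => by ring
      _ = 0 := by simp only [sum_mul_bitSign_mul_bitDeriv k (hy _), mul_zero, Finset.sum_const_zero]
  rw [h1, ← add_zero (∑ x, _), ← h2, ← Finset.sum_add_distrib, noiseForm]
  refine Finset.sum_congr rfl fun x _ => ?_
  rw [← Finset.sum_add_distrib]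
  refine Finset.sum_congr rfl fun y _ => ?_
  rw [hK]; ring

/-- The product rule applied to the kernel. Since the form is the second moment at `ρ = 1` and the
squared mean at `ρ = 0`, this expresses the variance through correlations of derivatives. -/
theorem hasDerivAt_noiseForm (f g : (ι → Bool) → ℝ) (ρ : ℝ) :
    HasDerivAt (fun ρ => noiseForm ρ f g) (∑ k, noiseForm ρ (bitDeriv k f) (bitDeriv k g)) ρ := by
  have : ∑ k, noiseForm ρ (bitDeriv k f) (bitDeriv k g) = ∑ x, ∑ y, (∑ k,
      (∏ j ∈ Finset.univ.erase k, (1 + ρ * (bitSign (x j) * bitSign (y j))) / 4) •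
        ((1 * (bitSign (x k) * bitSign (y k))) / 4)) * (f x * g y) := by
    simp only [noiseForm_bitDeriv, smul_eq_mul, one_mul, Finset.sum_mul]
    rw [Finset.sum_comm]
    refine Finset.sum_congr rfl fun x _ => ?_
    rw [Finset.sum_comm]
  rw [this]
  refine HasDerivAt.fun_sum fun x _ => HasDerivAt.fun_sum fun y _ => HasDerivAt.mul_const ?_ _
  refine HasDerivAt.fun_finsetProd fun k _ => ?_
  exact (((hasDerivAt_id ρ).mul_const _).const_add 1).div_const 4

theorem noiseForm_zero (f : (ι → Bool) → ℝ) : noiseForm 0 f f = cubeMean f ^ 2 := by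
  have h : ∀ x y : ι → Bool, noiseKernel 0 x y =
      (1 / 2) ^ Fintype.card ι * (1 / 2) ^ Fintype.card ι := by
    intro x y
    simp only [noiseKernel, zero_mul, add_zero, Finset.prod_const, Finset.card_univ]
    rw [← mul_pow]
    norm_num
  simp only [noiseForm, h, cubeMean]
  rw [mul_pow, pow_two (∑ x, f x), Finset.sum_mul_sum]
  simp only [Finset.mul_sum]
  refine Finset.sum_congr rfl fun x _ => Finset.sum_congr rfl fun y _ => ?_
  ring

theorem noiseForm_one (f : (ι → Bool) → ℝ) : noiseForm 1 f f = cubeMean fun x => f x ^ 2 := by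
  have h : ∀ x y : ι → Bool, noiseKernel 1 x y = if x = y then (1 / 2) ^ Fintype.card ι else 0 := by
    intro x y
    split_ifs with hxy
    · subst hxy
      simp only [noiseKernel, bitSign_mul_self, Finset.prod_const, Finset.card_univ]
      norm_num
    · obtain ⟨i, hi⟩ := Function.ne_iff.1 hxy
      refine Finset.prod_eq_zero (Finset.mem_univ i) ?_
      revert hi
      cases x i <;> cases y i <;> simp
  simp [noiseForm, h, cubeMean, Finset.mul_sum, pow_two]

theorem cubeMean_mono {f g : (ι → Bool) → ℝ} (h : ∀ x, f x ≤ g x) : cubeMean f ≤ cubeMean g :=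
  mul_le_mul_of_nonneg_left (Finset.sum_le_sum fun x _ => h x) (by positivity)

theorem cubeMean_const (c : ℝ) : cubeMean (fun _ : ι → Bool => c) = c := by
  simp [cubeMean]

theorem cubeMean_sum {κ : Type*} (s : Finset κ) (f : κ → (ι → Bool) → ℝ) :
    cubeMean (fun x => ∑ k ∈ s, f k x) = ∑ k ∈ s, cubeMean (f k) := by
  simp only [cubeMean, Finset.mul_sum]
  exact Finset.sum_comm

theorem noiseForm_le_noiseForm_abs {ρ : ℝ} (h0 : 0 ≤ ρ) (h1 : ρ ≤ 1) (f : (ι → Bool) → ℝ) :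
    noiseForm ρ f f ≤ noiseForm ρ (fun x => |f x|) (fun x => |f x|) := by
  refine Finset.sum_le_sum fun x _ => Finset.sum_le_sum fun y _ => ?_
  refine mul_le_mul_of_nonneg_left ?_ (noiseKernel_nonneg h0 h1 x y)
  rw [← abs_mul]
  exact le_abs_self _

/-- Interpolation of the `L^(1+ρ)` norm between `L¹` and `L²`. -/
theorem cubeMean_rpow_le {ρ : ℝ} (h0 : 0 < ρ) (h1 : ρ < 1) {g : (ι → Bool) → ℝ}
    (hg : ∀ x, 0 ≤ g x) :
    cubeMean (fun x => g x ^ (1 + ρ)) ≤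
      cubeMean g ^ (1 - ρ) * cubeMean (fun x => g x ^ 2) ^ ρ := by
  -- Hölder for the splitting `g^(1+ρ) = g^(1-ρ) · g^(2ρ)`.
  have hc : Real.HolderConjugate (1 / (1 - ρ)) (1 / ρ) := by
    rw [Real.holderConjugate_iff]
    refine ⟨by rw [lt_div_iff₀ (by linarith)]; linarith, by simp⟩
  have h := Real.inner_le_Lp_mul_Lq_of_nonneg Finset.univ hc
    (f := fun x => g x ^ (1 - ρ)) (g := fun x => g x ^ (2 * ρ))
    (fun x _ => Real.rpow_nonneg (hg x) _) (fun x _ => Real.rpow_nonneg (hg x) _)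
  have e1 : ∀ x, g x ^ (1 - ρ) * g x ^ (2 * ρ) = g x ^ (1 + ρ) := fun x => by
    rw [← Real.rpow_add_of_nonneg (hg x) (by linarith) (by linarith)]; ring_nf
  have e2 : ∀ x, (g x ^ (1 - ρ)) ^ (1 / (1 - ρ)) = g x := fun x => by
    rw [← Real.rpow_mul (hg x), mul_one_div_cancel (by linarith), Real.rpow_one]
  have e3 : ∀ x, (g x ^ (2 * ρ)) ^ (1 / ρ) = g x ^ 2 := fun x => by
    rw [← Real.rpow_mul (hg x), ← Real.rpow_natCast]; congr 1; push_cast; field_simp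
  simp only [e1, e2, e3, one_div_one_div] at h
  simp only [cubeMean]
  have hs1 : 0 ≤ ∑ x, g x := Finset.sum_nonneg fun x _ => hg x
  have hs2 : 0 ≤ ∑ x, g x ^ 2 := Finset.sum_nonneg fun x _ => sq_nonneg _
  set c : ℝ := (1 / 2) ^ Fintype.card ι with hcdef
  have hc0 : 0 < c := by positivity
  rw [Real.mul_rpow hc0.le hs1, Real.mul_rpow hc0.le hs2]
  calc c * ∑ x, g x ^ (1 + ρ) ≤ (c ^ (1 - ρ) * c ^ ρ) * ((∑ x, g x) ^ (1 - ρ) *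
        (∑ x, g x ^ 2) ^ ρ) := by
        rw [← Real.rpow_add hc0, sub_add_cancel, Real.rpow_one]
        exact mul_le_mul_of_nonneg_left h hc0.le
    _ = _ := by ring

/-- The correlation of a function with its noisy copy, bounded by its first two moments. -/
theorem noiseForm_self_le {ρ ℓ m : ℝ} (h0 : 0 < ρ) (h1 : ρ < 1) (hℓ : 0 ≤ ℓ) (hm : 0 < m)
    {g : (ι → Bool) → ℝ} (hg1 : m * cubeMean (fun x => |g x|) ^ 2 ≤ Real.exp (-ℓ))
    (hg2 : m * cubeMean (fun x => g x ^ 2) ≤ 1) :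
    noiseForm ρ g g ≤ Real.exp (-(ℓ * (1 - ρ) / 2)) / m := by
  have hb : 0 ≤ cubeMean (fun x => |g x|) := cubeMean_nonneg fun x => abs_nonneg _
  have ha : 0 ≤ cubeMean (fun x => g x ^ 2) := cubeMean_nonneg fun x => sq_nonneg _
  have hH := cubeMean_rpow_le h0 h1 (g := fun x => |g x|) fun x => abs_nonneg _
  simp only [sq_abs] at hH
  have hN : 0 ≤ cubeMean (fun x => |g x| ^ (1 + ρ)) :=
    cubeMean_nonneg fun x => Real.rpow_nonneg (abs_nonneg _) _
  have hb' : cubeMean (fun x => |g x|) ≤ (Real.exp (-ℓ) / m) ^ (1 / 2 : ℝ) := by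
    rw [← Real.sqrt_eq_rpow]
    apply Real.le_sqrt_of_sq_le
    rw [le_div_iff₀ hm]; linarith
  have ha' : cubeMean (fun x => g x ^ 2) ≤ 1 / m := by
    rw [le_div_iff₀ hm]; linarith
  calc noiseForm ρ g g ≤ _ := noiseForm_le_noiseForm_abs h0.le h1.le g
    _ ≤ _ := noiseForm_le h0.le h1.le (fun x => abs_nonneg _) (fun x => abs_nonneg _)
    _ = cubeMean (fun x => |g x| ^ (1 + ρ)) ^ (2 / (1 + ρ)) := by
        rw [← Real.rpow_add_of_nonneg hN (by positivity) (by positivity)]; ring_nf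
    _ ≤ (((Real.exp (-ℓ) / m) ^ (1 / 2 : ℝ)) ^ (1 - ρ) * (1 / m) ^ ρ) ^ (2 / (1 + ρ)) := by
        refine Real.rpow_le_rpow hN (hH.trans ?_) (by positivity)
        exact mul_le_mul (Real.rpow_le_rpow hb hb' (by linarith)) (Real.rpow_le_rpow ha ha' h0.le)
          (by positivity) (by positivity)
    -- The total power of `1/m` is `((1-ρ)/2 + ρ) · 2/(1+ρ) = 1`. The last step uses `1 + ρ ≤ 2`.
    _ = Real.exp (-(ℓ * (1 - ρ) / (1 + ρ))) / m := by
        have hm' : m = Real.exp (Real.log m) := (Real.exp_log hm).symm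
        rw [hm', one_div (Real.exp _), ← Real.exp_neg, ← Real.exp_sub, ← Real.exp_sub,
          ← Real.exp_mul, ← Real.exp_mul, ← Real.exp_mul, ← Real.exp_add, ← Real.exp_mul]
        congr 1
        field_simp
        ring
    _ ≤ _ := by
        gcongr
        linarith

/-- Superconcentration on the discrete cube for functions with a transitive symmetry group. -/
theorem cube_variance_le [Nonempty ι] {f : (ι → Bool) → ℝ} {B ℓ : ℝ} (hℓ : 0 ≤ ℓ)
    (hB : B ^ 2 ≤ Fintype.card ι * Real.exp (-ℓ))
    (hsymm : ∀ k l, ∃ e : ι ≃ ι, e k = l ∧ ∀ x, f (x ∘ e) = f x)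
    (h2 : ∀ x, ∑ k, bitDeriv k f x ^ 2 ≤ 1) (h1 : ∀ x, ∑ k, |bitDeriv k f x| ≤ B) :
    cubeMean (fun x => f x ^ 2) - cubeMean f ^ 2 ≤ 1 ∧
      (cubeMean (fun x => f x ^ 2) - cubeMean f ^ 2) * ℓ ≤ 2 := by
  set m : ℝ := (Fintype.card ι : ℝ) with hmdef
  have hm : 0 < m := by rw [hmdef]; exact_mod_cast Fintype.card_pos
  -- By transitivity every direction carries the share `1/m` of the total, so pointwise bounds on
  -- the sums become bounds on each single derivative.
  have htrans : ∀ (φ : ℝ → ℝ) (k : ι), m * cubeMean (fun x => φ (bitDeriv k f x)) =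
      cubeMean fun x => ∑ l, φ (bitDeriv l f x) := by
    intro φ k
    rw [cubeMean_sum, Finset.sum_congr rfl (g := fun _ => cubeMean fun x => φ (bitDeriv k f x))]
    · simp [hmdef]
    · intro l _
      obtain ⟨e, rfl, he⟩ := hsymm k l
      rw [← cubeMean_arrowCongr e.symm (fun x => φ (bitDeriv k f x))]
      simp only [Equiv.symm_symm, bitDeriv_comp_equiv he]
  have hderiv : ∀ ρ ∈ Set.Ioo (0 : ℝ) 1, ∑ k, noiseForm ρ (bitDeriv k f) (bitDeriv k f) ≤
      Real.exp (-(ℓ * (1 - ρ) / 2)) := by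
    intro ρ hρ
    calc _ ≤ ∑ k : ι, Real.exp (-(ℓ * (1 - ρ) / 2)) / m := by
          refine Finset.sum_le_sum fun k _ => noiseForm_self_le hρ.1 hρ.2 hℓ hm ?_ ?_
          · have h := (htrans (fun t => |t|) k).trans_le ((cubeMean_mono h1).trans_eq
              (cubeMean_const B))
            have hb : 0 ≤ cubeMean (fun x => |bitDeriv k f x|) :=
              cubeMean_nonneg fun x => abs_nonneg _
            have h' : (m * cubeMean fun x => |bitDeriv k f x|) ^ 2 ≤ B ^ 2 :=
              pow_le_pow_left₀ (by positivity) h 2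
            nlinarith
          · exact (htrans (fun t => t ^ 2) k).trans_le ((cubeMean_mono h2).trans_eq
              (cubeMean_const 1))
      _ = _ := by
          rw [Finset.sum_const, Finset.card_univ, nsmul_eq_mul, ← hmdef]
          field_simp
  have hc : ∀ ρ, HasDerivAt (fun ρ => noiseForm ρ f f) _ ρ := hasDerivAt_noiseForm f f
  rw [← noiseForm_one, ← noiseForm_zero]
  constructor
  · have hanti : AntitoneOn (fun ρ => noiseForm ρ f f - ρ) (Set.Icc 0 1) := by
      refine antitoneOn_of_hasDerivWithinAt_nonpos (convex_Icc 0 1)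
        (fun ρ _ => ((hc ρ).sub (hasDerivAt_id ρ)).continuousAt.continuousWithinAt)
        (fun ρ _ => ((hc ρ).sub (hasDerivAt_id ρ)).hasDerivWithinAt) fun ρ hρ => ?_
      rw [interior_Icc] at hρ
      have h := hderiv ρ hρ
      have : Real.exp (-(ℓ * (1 - ρ) / 2)) ≤ 1 := by
        rw [Real.exp_le_one_iff]
        have := mul_nonneg hℓ (sub_nonneg.2 hρ.2.le)
        linarith
      linarith
    have := hanti (Set.left_mem_Icc.2 zero_le_one) (Set.right_mem_Icc.2 zero_le_one) zero_le_one
    simp only at this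
    linarith
  -- An antiderivative of `ℓ` times the derivative bound. Keeping the factor `ℓ` avoids dividing
  -- when `ℓ = 0`.
  · have hE : ∀ ρ : ℝ, HasDerivAt (fun ρ => 2 * Real.exp (-(ℓ * (1 - ρ) / 2)))
        (ℓ * Real.exp (-(ℓ * (1 - ρ) / 2))) ρ := by
      intro ρ
      have h := (((((hasDerivAt_id ρ).const_sub 1).const_mul ℓ).div_const 2).neg.exp).const_mul 2
      refine h.congr_deriv ?_
      simp only [id, Pi.neg_apply]
      ring
    have hanti : AntitoneOn (fun ρ => ℓ * noiseForm ρ f f - 2 * Real.exp (-(ℓ * (1 - ρ) / 2)))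
        (Set.Icc 0 1) := by
      refine antitoneOn_of_hasDerivWithinAt_nonpos (convex_Icc 0 1)
        (fun ρ _ => (((hc ρ).const_mul ℓ).sub (hE ρ)).continuousAt.continuousWithinAt)
        (fun ρ _ => (((hc ρ).const_mul ℓ).sub (hE ρ)).hasDerivWithinAt) fun ρ hρ => ?_
      rw [interior_Icc] at hρ
      have := mul_le_mul_of_nonneg_left (hderiv ρ hρ) hℓ
      linarith
    have := hanti (Set.left_mem_Icc.2 zero_le_one) (Set.right_mem_Icc.2 zero_le_one) zero_le_one
    simp only [sub_self, mul_zero, zero_div, neg_zero, Real.exp_zero] at this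
    have := Real.exp_pos (-(ℓ * (1 - 0) / 2))
    linarith

end Cube

/-! ### Central limit theorem for normalised sums of signs -/

section BitSum

variable {ι : Type*}

/-- Normalised sums of signs, one for each coordinate. -/
noncomputable def bitSum (K : ℕ) (x : ι × Fin K → Bool) : EuclideanSpace ℝ ι :=
  WithLp.toLp 2 fun a => (√K)⁻¹ * ∑ k, bitSign (x (a, k))

/-- Bits within a block are exchangeable, so a symmetry group transitive on `ι` yields one
transitive on `ι × Fin K`. -/
theorem bitSum_comp_prodCongr (K : ℕ) (e : ι ≃ ι) (σ : Fin K ≃ Fin K) (x : ι × Fin K → Bool) :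
    bitSum K (x ∘ e.prodCongr σ) = WithLp.toLp 2 (bitSum K x ∘ e) := by
  ext a
  simp only [bitSum, Function.comp_apply, Equiv.prodCongr_apply, Prod.map_apply]
  congr 1
  exact Equiv.sum_comp σ fun k => bitSign (x (e a, k))

variable [DecidableEq ι]

theorem bitSum_bitFlip (K : ℕ) (p : ι × Fin K) (x : ι × Fin K → Bool) :
    bitSum K (bitFlip p x) =
      bitSum K x + (-2 * (√K)⁻¹ * bitSign (x p)) • EuclideanSpace.single p.1 1 := by
  obtain ⟨a, k⟩ := p
  ext b
  simp only [bitSum, PiLp.add_apply, PiLp.smul_apply, smul_eq_mul, PiLp.single_apply]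
  by_cases hb : b = a
  · subst hb
    have : ∑ j, bitSign (bitFlip (b, k) x (b, j)) =
        ∑ j, (bitSign (x (b, j)) + if j = k then -2 * bitSign (x (b, k)) else 0) := by
      refine Finset.sum_congr rfl fun j _ => ?_
      by_cases hj : j = k
      · subst hj
        rw [bitFlip_apply_self, bitSign_not, if_pos rfl]
        ring
      · rw [bitFlip_apply_of_ne (by simp [hj]), if_neg hj, add_zero]
    rw [this, Finset.sum_add_distrib]
    simp
    ring
  · simp only [hb, if_false, mul_zero, add_zero]
    congr 1
    refine Finset.sum_congr rfl fun j _ => ?_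
    rw [bitFlip_apply_of_ne (by simp [hb])]

variable [Fintype ι]

theorem cubeMean_eq_integral (f : (ι → Bool) → ℝ) :
    cubeMean f = ∫ x, f x ∂(PMF.uniformOfFintype (ι → Bool)).toMeasure := by
  rw [PMF.integral_eq_sum]
  simp [cubeMean, Finset.mul_sum]

theorem charFun_map_bitSign (u : ℝ) :
    charFun ((PMF.uniformOfFintype Bool).toMeasure.map bitSign) u = Complex.cos u := by
  rw [charFun_apply, integral_map (Measurable.of_discrete).aemeasurable (by fun_prop),
    PMF.integral_eq_sum]
  simp [Complex.cos]
  ring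

/-- The law of the normalised sums of signs. -/
noncomputable def bitSumLaw (ι : Type*) [Fintype ι] [DecidableEq ι] (K : ℕ) :
    ProbabilityMeasure (EuclideanSpace ℝ ι) :=
  ⟨(PMF.uniformOfFintype (ι × Fin K → Bool)).toMeasure.map (bitSum K),
    Measure.isProbabilityMeasure_map (Measurable.of_discrete).aemeasurable⟩

theorem charFun_bitSumLaw (K : ℕ) (t : EuclideanSpace ℝ ι) :
    charFun (bitSumLaw ι K : Measure (EuclideanSpace ℝ ι)) t =
      ∏ a, Complex.cos ((((√K)⁻¹ * t a : ℝ)) : ℂ) ^ K := by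
  have h1 : ∀ a, Complex.cos ((((√K)⁻¹ * t a : ℝ)) : ℂ) ^ K = ∏ k : Fin K, ∑ b : Bool,
      (1 / 2 : ℂ) * Complex.exp (((√K)⁻¹ * t a * bitSign b : ℝ) * Complex.I) := by
    intro a
    simp [Complex.cos]
    congr 1
    ring
  simp only [h1]
  rw [← Fintype.prod_prod_type' (fun (a : ι) (_ : Fin K) => ∑ b : Bool,
      (1 / 2 : ℂ) * Complex.exp (((√K)⁻¹ * t a * bitSign b : ℝ) * Complex.I)),
    Finset.prod_univ_sum, Fintype.piFinset_univ, charFun_apply]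
  simp only [bitSumLaw, ProbabilityMeasure.coe_mk]
  rw [integral_map (Measurable.of_discrete).aemeasurable (by fun_prop), PMF.integral_eq_sum]
  refine Finset.sum_congr rfl fun x _ => ?_
  rw [Finset.prod_mul_distrib, ← Complex.exp_sum]
  have h2 : inner ℝ (bitSum K x) t = ∑ p : ι × Fin K, (√K)⁻¹ * t p.1 * bitSign (x p) := by
    rw [Fintype.sum_prod_type, PiLp.inner_apply]
    refine Finset.sum_congr rfl fun a _ => ?_
    simp only [bitSum, RCLike.inner_apply, conj_trivial, Finset.mul_sum]
    exact Finset.sum_congr rfl fun k _ => by ring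
  rw [h2, ← Finset.sum_mul, Complex.ofReal_sum]
  simp

/-- Lévy's continuity theorem: each factor `cos(t/√K)^K` tends to `exp(-t²/2)`. -/
theorem tendsto_bitSumLaw :
    Filter.Tendsto (bitSumLaw ι) Filter.atTop
      (nhds (⟨stdGaussian (EuclideanSpace ℝ ι), inferInstance⟩ :
        ProbabilityMeasure (EuclideanSpace ℝ ι))) := by
  refine ProbabilityMeasure.tendsto_iff_tendsto_charFun.2 fun t => ?_
  simp only [charFun_bitSumLaw, ProbabilityMeasure.coe_mk]
  have h : charFun (stdGaussian (EuclideanSpace ℝ ι)) t =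
      ∏ a, Complex.exp (-(t a : ℂ) ^ 2 / 2) := by
    rw [charFun_stdGaussian, ← Complex.exp_sum]
    congr 1
    rw [← Complex.ofReal_pow, EuclideanSpace.real_norm_sq_eq, Complex.ofReal_sum,
      ← Finset.sum_div, Finset.sum_neg_distrib]
    simp
  rw [h]
  refine tendsto_finsetProd _ fun a _ => ?_
  have hb := tendsto_charFun_inv_sqrt_mul_pow (P := (PMF.uniformOfFintype Bool).toMeasure)
    (X := bitSign) (Measurable.of_discrete).aemeasurable
    (by rw [PMF.integral_eq_sum]; simp)
    (by rw [PMF.integral_eq_sum]; simp; norm_num) (t a)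
  simpa only [charFun_map_bitSign] using hb

theorem tendsto_cubeMean_bitSum {g : EuclideanSpace ℝ ι → ℝ} (hg : Continuous g) {C : ℝ}
    (hC : ∀ x, |g x| ≤ C) :
    Filter.Tendsto (fun K : ℕ => cubeMean fun x : ι × Fin K → Bool => g (bitSum K x))
      Filter.atTop (nhds (∫ x, g x ∂stdGaussian (EuclideanSpace ℝ ι))) := by
  have h := (ProbabilityMeasure.tendsto_iff_forall_integral_tendsto.1
    (tendsto_bitSumLaw (ι := ι))) (BoundedContinuousFunction.ofNormedAddCommGroup g hg C hC)
  refine h.congr fun K => ?_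
  rw [cubeMean_eq_integral]
  simp only [bitSumLaw, ProbabilityMeasure.coe_mk]
  rw [integral_map (Measurable.of_discrete).aemeasurable
    (by exact hg.aestronglyMeasurable)]
  rfl

end BitSum

/-! ### Gaussian variance bound for functions with Lipschitz gradient -/

section Smooth

variable {ι : Type*} [Fintype ι]

/-- `1`-Lipschitz for the Euclidean norm, `L`-Lipschitz for the maximum norm, and invariant under a
transitive set of permutations of the coordinates. -/
structure SymmetricLipschitz (L : ℝ) (f : EuclideanSpace ℝ ι → ℝ) : Prop where
  lip : ∀ x y, |f x - f y| ≤ ‖x - y‖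
  lip_sup : ∀ x y s, (∀ a, |x a - y a| ≤ s) → |f x - f y| ≤ L * s
  symm : ∀ a b, ∃ e : ι ≃ ι, e a = b ∧ ∀ x : EuclideanSpace ℝ ι, f (WithLp.toLp 2 (x ∘ e)) = f x

theorem abs_apply_le_of_hasFDerivAt {E : Type*} [NormedAddCommGroup E] [NormedSpace ℝ E]
    {f : E → ℝ} {f' : E →L[ℝ] ℝ} {x v : E} {c : ℝ} (hf : HasFDerivAt f f' x) (hc : 0 ≤ c)
    (h : ∀ s : ℝ, |f (x + s • v) - f x| ≤ c * |s|) : |f' v| ≤ c := by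
  have hd : HasDerivAt (fun s : ℝ => f (x + s • v)) (f' v) 0 := by
    have h1 : HasDerivAt (fun s : ℝ => x + s • v) v 0 := by
      simpa using ((hasDerivAt_id (0 : ℝ)).smul_const v).const_add x
    have h2 : HasFDerivAt f f' (x + (0 : ℝ) • v) := by simpa using hf
    exact h2.comp_hasDerivAt 0 h1
  exact hd.le_of_lip' hc (Filter.Eventually.of_forall fun s => by simpa using h s)

theorem abs_sub_sub_apply_le_of_lipschitz_fderiv {E : Type*} [NormedAddCommGroup E]
    [NormedSpace ℝ E] {f : E → ℝ} {f' : E → E →L[ℝ] ℝ} {C : ℝ} (hC : 0 ≤ C)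
    (hf : ∀ x, HasFDerivAt f (f' x) x) (hlip : ∀ x y, ‖f' x - f' y‖ ≤ C * ‖x - y‖) (x h : E) :
    |f (x + h) - f x - f' x h| ≤ C * ‖h‖ ^ 2 := by
  have := (convex_closedBall x ‖h‖).norm_image_sub_le_of_norm_hasFDerivWithin_le'
    (f := f) (f' := f') (φ := f' x) (C := C * ‖h‖) (x := x) (y := x + h)
    (fun z _ => (hf z).hasFDerivWithinAt)
    (fun z hz => (hlip z x).trans (mul_le_mul_of_nonneg_left (mem_closedBall_iff_norm.1 hz) hC))
    (by simp) (by simp)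
  simpa [pow_two, mul_assoc] using this

variable [DecidableEq ι]

/-- Duality between the `ℓ¹` and maximum norms: test the derivative on the vector of signs of its
coordinates. -/
theorem SymmetricLipschitz.sum_abs_fderiv_le {L : ℝ} (hL : 0 ≤ L) {f : EuclideanSpace ℝ ι → ℝ}
    (h : SymmetricLipschitz L f) {f' : EuclideanSpace ℝ ι →L[ℝ] ℝ} {x : EuclideanSpace ℝ ι}
    (hf : HasFDerivAt f f' x) : ∑ a, |f' (EuclideanSpace.single a 1)| ≤ L := by
  set v : EuclideanSpace ℝ ι :=
    ∑ a, (SignType.sign (f' (EuclideanSpace.single a 1)) : ℝ) • EuclideanSpace.single a 1 with hv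
  have hv1 : ∀ a, |v a| ≤ 1 := by
    intro a
    have : v a = (SignType.sign (f' (EuclideanSpace.single a 1)) : ℝ) := by
      simp [hv, Pi.single_apply]
    rw [this]
    cases SignType.sign (f' (EuclideanSpace.single a 1)) <;> simp
  have h1 : |f' v| ≤ L := abs_apply_le_of_hasFDerivAt hf hL fun s =>
    h.lip_sup _ _ _ fun a => by
      simp only [PiLp.add_apply, PiLp.smul_apply, smul_eq_mul, add_sub_cancel_left, abs_mul]
      exact mul_le_of_le_one_right (abs_nonneg s) (hv1 a)
  have h2 : f' v = ∑ a, |f' (EuclideanSpace.single a 1)| := by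
    rw [hv, map_sum]
    refine Finset.sum_congr rfl fun a _ => ?_
    rw [map_smul, smul_eq_mul, sign_mul_self]
  rw [← h2]
  exact (le_abs_self _).trans h1

/-- Test the derivative on the gradient itself. -/
theorem SymmetricLipschitz.sum_sq_fderiv_le {L : ℝ} {f : EuclideanSpace ℝ ι → ℝ}
    (h : SymmetricLipschitz L f) {f' : EuclideanSpace ℝ ι →L[ℝ] ℝ} {x : EuclideanSpace ℝ ι}
    (hf : HasFDerivAt f f' x) : ∑ a, f' (EuclideanSpace.single a 1) ^ 2 ≤ 1 := by
  set v : EuclideanSpace ℝ ι :=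
    ∑ a, f' (EuclideanSpace.single a 1) • EuclideanSpace.single a 1 with hv
  set S := ∑ a, f' (EuclideanSpace.single a 1) ^ 2 with hS
  have hva : ∀ a, v a = f' (EuclideanSpace.single a 1) := by
    intro a
    simp [hv, Pi.single_apply]
  have hnorm : ‖v‖ ^ 2 = S := by
    rw [EuclideanSpace.real_norm_sq_eq]
    simp only [hva, hS]
  have h1 : |f' v| ≤ ‖v‖ := abs_apply_le_of_hasFDerivAt hf (norm_nonneg v) fun s =>
    (h.lip _ _).trans_eq (by rw [add_sub_cancel_left, norm_smul, Real.norm_eq_abs, mul_comm])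
  have h2 : f' v = S := by
    rw [hv, map_sum]
    refine Finset.sum_congr rfl fun a _ => ?_
    rw [map_smul, smul_eq_mul, pow_two]
  rw [h2, ← hnorm, abs_of_nonneg (sq_nonneg _)] at h1
  rw [← hnorm]
  have := norm_nonneg v
  by_contra! hcon
  nlinarith

theorem cubeMean_const_mul (c : ℝ) (f : (ι → Bool) → ℝ) :
    cubeMean (fun x => c * f x) = c * cubeMean f := by
  simp only [cubeMean, ← Finset.mul_sum]
  ring

/-- A bit flip moves one coordinate by `2/√K`, so a discrete derivative is a partial derivative over
`√K` up to `O(1/K)`. Summed over bits, the gradient bounds survive up to a factor `1 + δ` with `δ →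
0`, and `f/(1 + δ)` satisfies the hypotheses on the cube with `B = √K L`. -/
theorem SymmetricLipschitz.cube_variance_bitSum_le [Nonempty ι] {L ℓ C : ℝ} (hL : 1 ≤ L)
    (hℓ : 0 ≤ ℓ) (hLℓ : L ^ 2 ≤ Fintype.card ι * Real.exp (-ℓ)) (hC : 0 ≤ C)
    {f : EuclideanSpace ℝ ι → ℝ} (h : SymmetricLipschitz L f)
    {f' : EuclideanSpace ℝ ι → EuclideanSpace ℝ ι →L[ℝ] ℝ} (hf : ∀ x, HasFDerivAt f (f' x) x)
    (hlip : ∀ x y, ‖f' x - f' y‖ ≤ C * ‖x - y‖) {K : ℕ} (hK : K ≠ 0) :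
    cubeMean (fun x : ι × Fin K → Bool => f (bitSum K x) ^ 2) -
        cubeMean (fun x : ι × Fin K → Bool => f (bitSum K x)) ^ 2 ≤
          (1 + 2 * Fintype.card ι * C * (√K)⁻¹) ^ 2 ∧
      (cubeMean (fun x : ι × Fin K → Bool => f (bitSum K x) ^ 2) -
        cubeMean (fun x : ι × Fin K → Bool => f (bitSum K x)) ^ 2) * ℓ ≤
          2 * (1 + 2 * Fintype.card ι * C * (√K)⁻¹) ^ 2 := by
  have : NeZero K := ⟨hK⟩
  set n : ℝ := (Fintype.card ι : ℝ) with hn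
  set t : ℝ := (√K)⁻¹ with ht
  have hKpos : (0 : ℝ) < K := by positivity
  have ht0 : 0 < t := by positivity
  have hKt : K * t ^ 2 = 1 := by
    rw [ht, inv_pow, Real.sq_sqrt hKpos.le]; field_simp
  have hKt' : K * t = √K := by
    rw [ht, ← div_eq_mul_inv, Real.div_sqrt]
  have hn0 : 0 ≤ n := by positivity
  set δ : ℝ := 2 * n * C * t with hδ
  have hδ0 : 0 ≤ δ := by positivity
  set d : EuclideanSpace ℝ ι → ι → ℝ := fun x a => |f' x (EuclideanSpace.single a 1)| with hd
  have hd1 : ∀ x, ∑ a, d x a ≤ L := fun x => h.sum_abs_fderiv_le (by linarith) (hf x)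
  have hd2 : ∀ x, ∑ a, d x a ^ 2 ≤ 1 := fun x => by
    simpa only [hd, sq_abs] using h.sum_sq_fderiv_le (hf x)
  have hd0 : ∀ x a, 0 ≤ d x a := fun x a => abs_nonneg _
  have hdn : ∀ x, ∑ a, d x a ≤ n := fun x => by
    refine (Finset.sum_le_sum (g := fun _ => (1 : ℝ)) fun a _ => ?_).trans_eq (by simp [hn])
    have := (Finset.single_le_sum (f := fun a => d x a ^ 2) (fun a _ => sq_nonneg _)
      (Finset.mem_univ a)).trans (hd2 x)
    nlinarith [hd0 x a]
  -- The Taylor remainder `C(2t)²` is halved by the definition of `bitDeriv`.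
  have hD : ∀ (p : ι × Fin K) (x : ι × Fin K → Bool),
      |bitDeriv p (fun x => f (bitSum K x)) x| ≤ t * d (bitSum K x) p.1 + 2 * C * t ^ 2 := by
    intro p x
    rw [abs_bitDeriv, bitSum_bitFlip]
    set c : ℝ := -2 * t * bitSign (x p) with hc
    have hc' : |c| = 2 * t := by
      rw [hc, abs_mul, abs_bitSign, abs_mul, abs_of_pos ht0]; norm_num
    have h1 := abs_sub_sub_apply_le_of_lipschitz_fderiv hC hf hlip (bitSum K x)
      (c • EuclideanSpace.single p.1 1)
    rw [norm_smul, Real.norm_eq_abs, hc', PiLp.norm_single, norm_one, mul_one, map_smul,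
      smul_eq_mul] at h1
    have h2 : |c * f' (bitSum K x) (EuclideanSpace.single p.1 1)| = 2 * t * d (bitSum K x) p.1 := by
      rw [abs_mul, hc']
    have h3 := abs_sub_abs_le_abs_sub (f (bitSum K x + c • EuclideanSpace.single p.1 1) -
      f (bitSum K x)) (c * f' (bitSum K x) (EuclideanSpace.single p.1 1))
    rw [h2] at h3
    nlinarith
  have hsum : ∀ (φ : ι → ℝ), ∑ p : ι × Fin K, φ p.1 = K * ∑ a, φ a := by
    intro φ
    rw [Fintype.sum_prod_type, Finset.mul_sum]
    simp
  have hDs : ∀ (p : ι × Fin K) (x : ι × Fin K → Bool),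
      bitDeriv p (fun x => (1 + δ)⁻¹ * f (bitSum K x)) x =
        (1 + δ)⁻¹ * bitDeriv p (fun x => f (bitSum K x)) x := by
    intro p x
    simp only [bitDeriv]
    ring
  have key := cube_variance_le (f := fun x : ι × Fin K → Bool => (1 + δ)⁻¹ * f (bitSum K x))
    (B := √K * L) hℓ ?_ ?_ ?_ ?_
  · have e1 : ∀ x : ι × Fin K → Bool, ((1 + δ)⁻¹ * f (bitSum K x)) ^ 2 =
        ((1 + δ)⁻¹) ^ 2 * f (bitSum K x) ^ 2 := fun x => mul_pow _ _ _
    simp only [e1, cubeMean_const_mul] at key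
    rw [mul_pow, ← mul_sub, mul_assoc, inv_pow, inv_mul_le_iff₀ (by positivity),
      inv_mul_le_iff₀ (by positivity), mul_one] at key
    exact ⟨key.1, key.2.trans_eq (mul_comm _ _)⟩
  · rw [mul_pow, Real.sq_sqrt hKpos.le, Fintype.card_prod, Fintype.card_fin, Nat.cast_mul]
    nlinarith
  · rintro ⟨a, k⟩ ⟨b, l⟩
    obtain ⟨e, he, hfe⟩ := h.symm a b
    refine ⟨e.prodCongr (Equiv.swap k l), by simp [he], fun x => ?_⟩
    simp only [bitSum_comp_prodCongr, hfe]
  · intro x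
    simp only [hDs, mul_pow, ← Finset.mul_sum]
    rw [inv_pow, inv_mul_le_iff₀ (by positivity), mul_one]
    calc _ ≤ ∑ p : ι × Fin K, (t * d (bitSum K x) p.1 + 2 * C * t ^ 2) ^ 2 :=
          Finset.sum_le_sum fun p _ => by
            rw [← sq_abs]
            exact pow_le_pow_left₀ (abs_nonneg _) (hD p x) 2
      _ = K * t ^ 2 * (∑ a, d (bitSum K x) a ^ 2 + 4 * C * t * ∑ a, d (bitSum K x) a
            + 4 * n * (C * t) ^ 2) := by
          rw [hsum fun a => (t * d (bitSum K x) a + 2 * C * t ^ 2) ^ 2]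
          have : ∑ a, (t * d (bitSum K x) a + 2 * C * t ^ 2) ^ 2 = ∑ a, (t ^ 2 *
              d (bitSum K x) a ^ 2 + 4 * C * t ^ 3 * d (bitSum K x) a + 4 * C ^ 2 * t ^ 4) :=
            Finset.sum_congr rfl fun a _ => by ring
          rw [this, Finset.sum_add_distrib, Finset.sum_add_distrib, ← Finset.mul_sum,
            ← Finset.mul_sum, Finset.sum_const, Finset.card_univ, nsmul_eq_mul, ← hn]
          ring
      _ ≤ 1 + 4 * C * t * n + 4 * n * (C * t) ^ 2 := by
          rw [hKt, one_mul]
          have := mul_le_mul_of_nonneg_left (hdn (bitSum K x)) (by positivity : 0 ≤ 4 * C * t)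
          linarith [hd2 (bitSum K x)]
      -- The linear term is `2δ`, and `4n(Ct)² ≤ δ²` because `n ≥ 1`.
      _ ≤ (1 + δ) ^ 2 := by
          have hn1 : 1 ≤ n := by rw [hn]; exact_mod_cast Fintype.card_pos
          have : 4 * n * (C * t) ^ 2 ≤ 4 * n ^ 2 * (C * t) ^ 2 := by
            gcongr; nlinarith
          rw [hδ]
          nlinarith
  · intro x
    simp only [hDs, abs_mul, ← Finset.mul_sum]
    rw [abs_of_pos (by positivity), inv_mul_le_iff₀ (by positivity)]
    calc _ ≤ ∑ p : ι × Fin K, (t * d (bitSum K x) p.1 + 2 * C * t ^ 2) :=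
          Finset.sum_le_sum fun p _ => hD p x
      _ = √K * (∑ a, d (bitSum K x) a + δ) := by
          rw [hsum fun a => t * d (bitSum K x) a + 2 * C * t ^ 2, Finset.sum_add_distrib,
            ← Finset.mul_sum, Finset.sum_const, Finset.card_univ, nsmul_eq_mul, ← hn, ← hKt', hδ]
          ring
      -- `1 ≤ L` absorbs `δ` into `L * δ`.
      _ ≤ √K * (L + L * δ) := by
          gcongr
          · exact hd1 _
          · nlinarith
      _ = _ := by ring

theorem SymmetricLipschitz.variance_le_of_lipschitz_fderiv [Nonempty ι] {L ℓ C D : ℝ} (hL : 1 ≤ L)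
    (hℓ : 0 ≤ ℓ) (hLℓ : L ^ 2 ≤ Fintype.card ι * Real.exp (-ℓ)) (hC : 0 ≤ C)
    {f : EuclideanSpace ℝ ι → ℝ} (h : SymmetricLipschitz L f) (hD : ∀ x, |f x| ≤ D)
    {f' : EuclideanSpace ℝ ι → EuclideanSpace ℝ ι →L[ℝ] ℝ} (hf : ∀ x, HasFDerivAt f (f' x) x)
    (hlip : ∀ x y, ‖f' x - f' y‖ ≤ C * ‖x - y‖) :
    ∫ x, f x ^ 2 ∂stdGaussian (EuclideanSpace ℝ ι) -
        (∫ x, f x ∂stdGaussian (EuclideanSpace ℝ ι)) ^ 2 ≤ 1 ∧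
      (∫ x, f x ^ 2 ∂stdGaussian (EuclideanSpace ℝ ι) -
        (∫ x, f x ∂stdGaussian (EuclideanSpace ℝ ι)) ^ 2) * ℓ ≤ 2 := by
  have hcont : Continuous f := continuous_iff_continuousAt.2 fun x => (hf x).continuousAt
  have h1 := tendsto_cubeMean_bitSum hcont hD
  have h2 := tendsto_cubeMean_bitSum (g := fun x => f x ^ 2) (C := D ^ 2) (by fun_prop) fun x => by
    rw [abs_of_nonneg (sq_nonneg _), ← sq_abs]
    exact pow_le_pow_left₀ (abs_nonneg _) (hD x) 2
  have hV := h2.sub (h1.pow 2)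
  have hδ : Filter.Tendsto (fun K : ℕ => (1 + 2 * Fintype.card ι * C * (√K)⁻¹) ^ 2)
      Filter.atTop (nhds 1) := by
    have : Filter.Tendsto (fun K : ℕ => (√K)⁻¹) Filter.atTop (nhds 0) :=
      tendsto_inv_atTop_zero.comp (Real.tendsto_sqrt_atTop.comp tendsto_natCast_atTop_atTop)
    simpa using ((this.const_mul (2 * Fintype.card ι * C)).const_add 1).pow 2
  have hbound := fun K (hK : K ≠ 0) =>
    h.cube_variance_bitSum_le hL hℓ hLℓ hC hf hlip (K := K) hK
  constructor
  · refine le_of_tendsto_of_tendsto hV hδ ?_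
    filter_upwards [Filter.eventually_ne_atTop 0] with K hK using (hbound K hK).1
  · have := hδ.const_mul 2
    rw [mul_one] at this
    refine le_of_tendsto_of_tendsto (hV.mul_const ℓ) this ?_
    filter_upwards [Filter.eventually_ne_atTop 0] with K hK using (hbound K hK).2

end Smooth

/-! ### Mollification by radial densities -/

section Mollify

/-- A smooth, compactly supported, radial probability density. -/
structure RadialMollifier {E : Type*} [NormedAddCommGroup E] [NormedSpace ℝ E] [MeasureSpace E]
    (ε : ℝ) (ψ : E → ℝ) : Prop where
  contDiff : ContDiff ℝ 1 ψ
  hasCompactSupport : HasCompactSupport ψ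
  nonneg : ∀ x, 0 ≤ ψ x
  integral_eq_one : ∫ x, ψ x = 1
  radial : ∀ x y, ‖x‖ = ‖y‖ → ψ x = ψ y
  norm_le : ∀ x, ψ x ≠ 0 → ‖x‖ ≤ ε

variable {E : Type*} [NormedAddCommGroup E] [InnerProductSpace ℝ E] [FiniteDimensional ℝ E]
  [MeasurableSpace E] [BorelSpace E]

theorem exists_radialMollifier {ε : ℝ} (hε : 0 < ε) : ∃ ψ : E → ℝ, RadialMollifier ε ψ := by
  set φ : E → ℝ := fun x => Real.smoothTransition (1 - ‖x‖ ^ 2 / ε ^ 2) with hφ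
  have hcd : ContDiff ℝ 1 φ :=
    Real.smoothTransition.contDiff.comp (contDiff_const.sub ((contDiff_norm_sq ℝ).div_const _))
  have hle : ∀ x, φ x ≠ 0 → ‖x‖ ≤ ε := by
    intro x hx
    by_contra! h
    refine hx (Real.smoothTransition.zero_of_nonpos ?_)
    rw [sub_nonpos, one_le_div (by positivity)]
    gcongr
  have hcs : HasCompactSupport φ :=
    HasCompactSupport.intro (isCompact_closedBall (0 : E) ε) fun x hx => by
      by_contra h
      exact hx (by simpa using hle x h)
  have hpos : 0 < ∫ x, φ x := by
    refine hcd.continuous.integral_pos_of_hasCompactSupport_nonneg_nonzero hcs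
      (fun x => Real.smoothTransition.nonneg _) (x := 0) ?_
    simp [hφ, Real.smoothTransition.one]
  refine ⟨fun x => (∫ x, φ x)⁻¹ * φ x, contDiff_const.mul hcd, hcs.mul_left, fun x => ?_, ?_,
    fun x y h => ?_, fun x h => hle x (right_ne_zero_of_mul h)⟩
  · exact mul_nonneg (inv_nonneg.2 hpos.le) (Real.smoothTransition.nonneg _)
  · rw [integral_const_mul, inv_mul_cancel₀ hpos.ne']
  · simp only [hφ, h]

/-- Average of `f` against the translates of a density. -/
noncomputable def mollify (ψ f : E → ℝ) (x : E) : ℝ := ∫ t, ψ t * f (x - t)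

variable {ε : ℝ} {ψ : E → ℝ}

theorem RadialMollifier.integrable_mul (h : RadialMollifier ε ψ) {u : E → ℝ} (hu : Continuous u) :
    Integrable fun t => ψ t * u t := by
  have hc : Continuous ψ := ContDiff.continuous (𝕜 := ℝ) (n := 1) h.contDiff
  exact (hc.mul hu).integrable_of_hasCompactSupport h.hasCompactSupport.mul_right

theorem RadialMollifier.abs_integral_mul_le (h : RadialMollifier ε ψ) {u : E → ℝ} {c : ℝ}
    (hc : ∀ t, ‖t‖ ≤ ε → |u t| ≤ c) : |∫ t, ψ t * u t| ≤ c := by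
  have hi : Integrable fun t => ψ t * c := h.integrable_mul continuous_const
  have hle : ∀ t, ‖ψ t * u t‖ ≤ ψ t * c := fun t => by
    rw [norm_mul, Real.norm_eq_abs, Real.norm_eq_abs, abs_of_nonneg (h.nonneg t)]
    by_cases ht : ψ t = 0
    · simp [ht]
    · exact mul_le_mul_of_nonneg_left (hc t (h.norm_le t ht)) (h.nonneg t)
  have := norm_integral_le_of_norm_le hi (Filter.Eventually.of_forall hle)
  rwa [integral_mul_const, h.integral_eq_one, one_mul] at this

theorem RadialMollifier.abs_mollify_sub_mollify_le (h : RadialMollifier ε ψ) {f : E → ℝ}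
    (hf : Continuous f) {x y : E} {c : ℝ} (hc : ∀ t, |f (x - t) - f (y - t)| ≤ c) :
    |mollify ψ f x - mollify ψ f y| ≤ c := by
  rw [mollify, mollify, ← integral_sub (h.integrable_mul (by fun_prop))
    (h.integrable_mul (by fun_prop))]
  simp only [← mul_sub]
  exact h.abs_integral_mul_le fun t _ => hc t

theorem RadialMollifier.abs_mollify_sub_le (h : RadialMollifier ε ψ) {f : E → ℝ}
    (hf : Continuous f) (hlip : ∀ x y, |f x - f y| ≤ ‖x - y‖) (x : E) :
    |mollify ψ f x - f x| ≤ ε := by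
  have : f x = ∫ t, ψ t * f x := by rw [integral_mul_const, h.integral_eq_one, one_mul]
  rw [mollify, this, ← integral_sub (h.integrable_mul (by fun_prop))
    (h.integrable_mul (by fun_prop))]
  simp only [← mul_sub]
  exact h.abs_integral_mul_le fun t ht => (hlip _ _).trans (by simpa using ht)

/-- The derivative falls on `ψ`, so the gradient is an average of translates of the Lipschitz `f`
against `∇ψ`, hence Lipschitz with constant `∫ ‖∇ψ‖`. -/
theorem RadialMollifier.exists_hasFDerivAt_mollify (h : RadialMollifier ε ψ) {f : E → ℝ}
    (hf : Continuous f) (hlip : ∀ x y, |f x - f y| ≤ ‖x - y‖) :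
    ∃ (f' : E → E →L[ℝ] ℝ) (C : ℝ), 0 ≤ C ∧ (∀ x, HasFDerivAt (mollify ψ f) (f' x) x) ∧
      ∀ x y, ‖f' x - f' y‖ ≤ C * ‖x - y‖ := by
  set L := ContinuousLinearMap.lsmul ℝ ℝ (E := ℝ)
  have hcf := h.hasCompactSupport.fderiv (𝕜 := ℝ)
  have hcont : Continuous (fderiv ℝ ψ) := h.contDiff.continuous_fderiv one_ne_zero
  refine ⟨convolution (fderiv ℝ ψ) f (L.precompL E) volume,
    ∫ t, ‖fderiv ℝ ψ t‖, integral_nonneg fun t => norm_nonneg _, fun x =>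
      h.hasCompactSupport.hasFDerivAt_convolution_left L h.contDiff hf.locallyIntegrable x,
      fun x y => ?_⟩
  have hex := hcf.convolutionExists_left (L.precompL E) (μ := volume) hcont hf.locallyIntegrable
  have hi : Integrable fun t => ‖fderiv ℝ ψ t‖ := (hcont.integrable_of_hasCompactSupport hcf).norm
  rw [convolution, convolution, ← integral_sub (hex x) (hex y), ← integral_mul_const]
  refine norm_integral_le_of_norm_le (hi.mul_const _) (Filter.Eventually.of_forall fun t => ?_)
  rw [← map_sub]
  refine ContinuousLinearMap.opNorm_le_bound _ (by positivity) fun v => ?_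
  rw [ContinuousLinearMap.precompL_apply, ContinuousLinearMap.lsmul_apply, norm_smul,
    mul_right_comm]
  exact mul_le_mul ((fderiv ℝ ψ t).le_opNorm v) (by simpa using hlip (x - t) (y - t))
    (norm_nonneg _) (by positivity)

end Mollify

/-! ### Removing smoothness and boundedness -/

section Gaussian

variable {ι : Type*} [Fintype ι]

theorem SymmetricLipschitz.continuous {L : ℝ} {f : EuclideanSpace ℝ ι → ℝ}
    (h : SymmetricLipschitz L f) : Continuous f :=
  (LipschitzWith.of_dist_le' (K := 1) fun x y => by
    rw [Real.dist_eq, dist_eq_norm, one_mul]; exact h.lip x y).continuous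

/-- Lipschitz bounds pass to averages of translates. Coordinate permutations are isometries
preserving Lebesgue measure and the radial density, so the symmetry persists. -/
theorem SymmetricLipschitz.mollification {L ε : ℝ} {f : EuclideanSpace ℝ ι → ℝ}
    (h : SymmetricLipschitz L f) {ψ : EuclideanSpace ℝ ι → ℝ} (hψ : RadialMollifier ε ψ) :
    SymmetricLipschitz L (mollify ψ f) where
  lip x y := hψ.abs_mollify_sub_mollify_le h.continuous fun t => by
    simpa using h.lip (x - t) (y - t)
  lip_sup x y s hs := hψ.abs_mollify_sub_mollify_le h.continuous fun t =>
    h.lip_sup _ _ _ fun a => by simpa using hs a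
  symm a b := by
    obtain ⟨e, he, hf⟩ := h.symm a b
    refine ⟨e, he, fun x => ?_⟩
    set T := LinearIsometryEquiv.piLpCongrLeft 2 ℝ ℝ e.symm with hT
    have hTx : ∀ y, WithLp.toLp 2 (y.ofLp ∘ e) = T y := fun y => by
      ext i
      simp [hT, LinearIsometryEquiv.piLpCongrLeft_apply]
    have hT' : ∀ y, f (T y) = f y := fun y => by rw [← hTx, hf]
    rw [hTx, mollify, mollify,
      ← T.measurePreserving.integral_comp T.toHomeomorph.measurableEmbedding]
    refine integral_congr_ae (Filter.Eventually.of_forall fun t => ?_)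
    simp only [← map_sub, hT']
    rw [hψ.radial (T t) t (T.norm_map t)]

theorem SymmetricLipschitz.clamp {L : ℝ} {f : EuclideanSpace ℝ ι → ℝ}
    (h : SymmetricLipschitz L f) (T : ℝ) :
    SymmetricLipschitz L (fun x => max (-T) (min T (f x))) := by
  have hc : ∀ a b : ℝ, |max (-T) (min T a) - max (-T) (min T b)| ≤ |a - b| := by
    intro a b
    have h1 := abs_max_sub_max_le_max (-T) (min T a) (-T) (min T b)
    have h2 := abs_min_sub_min_le_max T a T b
    rw [sub_self, abs_zero, max_eq_right (abs_nonneg (min T a - min T b))] at h1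
    rw [sub_self, abs_zero, max_eq_right (abs_nonneg (a - b))] at h2
    exact h1.trans h2
  refine ⟨fun x y => (hc _ _).trans (h.lip x y),
    fun x y s hs => (hc _ _).trans (h.lip_sup x y s hs), fun a b => ?_⟩
  obtain ⟨e, he, hf⟩ := h.symm a b
  exact ⟨e, he, fun x => by rw [hf]⟩

theorem SymmetricLipschitz.memLp {L : ℝ} {f : EuclideanSpace ℝ ι → ℝ}
    (h : SymmetricLipschitz L f) : MemLp f 2 (stdGaussian (EuclideanSpace ℝ ι)) := by
  have h1 : MemLp (fun x : EuclideanSpace ℝ ι => |f 0| + ‖x‖) 2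
      (stdGaussian (EuclideanSpace ℝ ι)) := by
    have h0 := (IsGaussian.memLp_id (stdGaussian (EuclideanSpace ℝ ι)) 2 ENNReal.ofNat_ne_top).norm
    exact (memLp_const |f 0|).add h0
  refine h1.mono h.continuous.aestronglyMeasurable (Filter.Eventually.of_forall fun x => ?_)
  have := h.lip x 0
  rw [sub_zero] at this
  rw [Real.norm_eq_abs, Real.norm_eq_abs, abs_of_nonneg (by positivity : 0 ≤ |f 0| + ‖x‖)]
  have := abs_sub_abs_le_abs_sub (f x) (f 0)
  linarith

variable [DecidableEq ι] [Nonempty ι]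

theorem SymmetricLipschitz.variance_le_of_bounded {L ℓ D : ℝ} (hL : 1 ≤ L)
    (hℓ : 0 ≤ ℓ) (hLℓ : L ^ 2 ≤ Fintype.card ι * Real.exp (-ℓ))
    {f : EuclideanSpace ℝ ι → ℝ} (h : SymmetricLipschitz L f) (hD : ∀ x, |f x| ≤ D) :
    ∫ x, f x ^ 2 ∂stdGaussian (EuclideanSpace ℝ ι) -
        (∫ x, f x ∂stdGaussian (EuclideanSpace ℝ ι)) ^ 2 ≤ 1 ∧
      (∫ x, f x ^ 2 ∂stdGaussian (EuclideanSpace ℝ ι) -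
        (∫ x, f x ∂stdGaussian (EuclideanSpace ℝ ι)) ^ 2) * ℓ ≤ 2 := by
  set γ := stdGaussian (EuclideanSpace ℝ ι)
  have hD0 : 0 ≤ D := (abs_nonneg _).trans (hD 0)
  have hint : ∀ g : EuclideanSpace ℝ ι → ℝ, Continuous g → (∀ x, |g x| ≤ D) → Integrable g γ :=
    fun g hg hb => Integrable.of_bound hg.aestronglyMeasurable D
      (Filter.Eventually.of_forall hb)
  have hint2 : ∀ g : EuclideanSpace ℝ ι → ℝ, Continuous g → (∀ x, |g x| ≤ D) →
      Integrable (fun x => g x ^ 2) γ :=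
    fun g hg hb => Integrable.of_bound (hg.pow 2).aestronglyMeasurable (D ^ 2)
      (Filter.Eventually.of_forall fun x => by
        rw [norm_pow, Real.norm_eq_abs]
        exact pow_le_pow_left₀ (abs_nonneg _) (hb x) 2)
  -- Mollifying moves `f` by at most `ε`, so the second moment and the squared mean each move by at
  -- most `2Dε`.
  have key : ∀ ε : ℝ, 0 < ε → ∃ V : ℝ, V ≤ 1 ∧ V * ℓ ≤ 2 ∧
      ∫ x, f x ^ 2 ∂γ - (∫ x, f x ∂γ) ^ 2 ≤ V + 4 * D * ε := by
    intro ε hε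
    obtain ⟨ψ, hψ⟩ := exists_radialMollifier (E := EuclideanSpace ℝ ι) hε
    obtain ⟨f', C, hC, hf', hC'⟩ := hψ.exists_hasFDerivAt_mollify h.continuous h.lip
    have hm := h.mollification hψ
    have hmD : ∀ x, |mollify ψ f x| ≤ D := fun x => hψ.abs_integral_mul_le fun t _ => hD _
    obtain ⟨h1, h2⟩ := hm.variance_le_of_lipschitz_fderiv hL hℓ hLℓ hC hmD hf' hC'
    refine ⟨_, h1, h2, ?_⟩
    have hclose := hψ.abs_mollify_sub_le h.continuous h.lip
    have hA : ∫ x, f x ^ 2 ∂γ ≤ ∫ x, mollify ψ f x ^ 2 ∂γ + 2 * D * ε := by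
      have hi := hint2 _ hm.continuous hmD
      have : ∫ x, mollify ψ f x ^ 2 ∂γ + 2 * D * ε = ∫ x, (mollify ψ f x ^ 2 + 2 * D * ε) ∂γ := by
        rw [integral_add hi (integrable_const _)]
        simp
      rw [this]
      refine integral_mono (hint2 _ h.continuous hD) (hi.add (integrable_const _)) fun x => ?_
      have e1 := abs_le.1 (hclose x)
      have e2 := abs_le.1 (hD x)
      have e3 := abs_le.1 (hmD x)
      have e4 : |(mollify ψ f x - f x) * (f x + mollify ψ f x)| ≤ ε * (2 * D) := by
        rw [abs_mul]
        exact mul_le_mul (hclose x) (abs_le.2 ⟨by linarith, by linarith⟩) (abs_nonneg _) hε.le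
      have e5 := (abs_le.1 e4).1
      simp only
      nlinarith
    have hB : (∫ x, mollify ψ f x ∂γ) ^ 2 ≤ (∫ x, f x ∂γ) ^ 2 + 2 * D * ε := by
      have b : ∀ g : EuclideanSpace ℝ ι → ℝ, (∀ x, |g x| ≤ D) → |∫ x, g x ∂γ| ≤ D := fun g hb => by
        simpa using norm_integral_le_of_norm_le_const (μ := γ)
          (f := g) (Filter.Eventually.of_forall hb)
      have e1 : |∫ x, mollify ψ f x ∂γ - ∫ x, f x ∂γ| ≤ ε := by
        rw [← integral_sub (hint _ hm.continuous hmD) (hint _ h.continuous hD)]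
        simpa using norm_integral_le_of_norm_le_const (μ := γ)
          (f := fun x => mollify ψ f x - f x) (Filter.Eventually.of_forall hclose)
      have e2 := abs_le.1 (b f hD)
      have e3 := abs_le.1 (b _ hmD)
      have e4 : |(∫ x, mollify ψ f x ∂γ - ∫ x, f x ∂γ) * (∫ x, f x ∂γ + ∫ x, mollify ψ f x ∂γ)|
          ≤ ε * (2 * D) := by
        rw [abs_mul]
        exact mul_le_mul e1 (abs_le.2 ⟨by linarith, by linarith⟩) (abs_nonneg _) hε.le
      have e5 := (abs_le.1 e4).2
      nlinarith
    linarith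
  constructor
  · refine le_of_forall_pos_le_add fun η hη => ?_
    obtain ⟨V, h1, -, h3⟩ := key (η / (4 * D + 1)) (by positivity)
    have : 4 * D * (η / (4 * D + 1)) ≤ η := by
      rw [mul_div_assoc', div_le_iff₀ (by positivity)]; nlinarith
    linarith
  · refine le_of_forall_pos_le_add fun η hη => ?_
    obtain ⟨V, -, h2, h3⟩ := key (η / (4 * D * ℓ + 1)) (by positivity)
    have : 4 * D * (η / (4 * D * ℓ + 1)) * ℓ ≤ η := by
      rw [mul_div_assoc', div_mul_eq_mul_div, div_le_iff₀ (by positivity)]; nlinarith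
    nlinarith [mul_le_mul_of_nonneg_right h3 hℓ]

/-- Superconcentration for functions of a Gaussian vector with a transitive symmetry group. -/
theorem SymmetricLipschitz.variance_le {L ℓ : ℝ} (hL : 1 ≤ L)
    (hℓ : 0 ≤ ℓ) (hLℓ : L ^ 2 ≤ Fintype.card ι * Real.exp (-ℓ))
    {f : EuclideanSpace ℝ ι → ℝ} (h : SymmetricLipschitz L f) :
    variance f (stdGaussian (EuclideanSpace ℝ ι)) ≤ 1 ∧
      variance f (stdGaussian (EuclideanSpace ℝ ι)) * ℓ ≤ 2 := by
  set γ := stdGaussian (EuclideanSpace ℝ ι)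
  have hmem : MemLp f 2 γ := h.memLp
  rw [variance_eq_sub hmem]
  simp only [Pi.pow_apply]
  -- Truncation at height `T` is a contraction and keeps all hypotheses. Dominated convergence then
  -- removes it.
  set F : ℕ → EuclideanSpace ℝ ι → ℝ := fun T x => max (-(T : ℝ)) (min (T : ℝ) (f x)) with hF
  have hFT : ∀ T : ℕ, SymmetricLipschitz L (F T) := fun T => h.clamp T
  have hFb : ∀ (T : ℕ) x, |F T x| ≤ T := fun T x =>
    abs_le.2 ⟨le_max_left _ _, max_le (by linarith [Nat.cast_nonneg (α := ℝ) T]) (min_le_left _ _)⟩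
  have hFf : ∀ (T : ℕ) x, |F T x| ≤ |f x| := fun T x => by
    have hT : (0 : ℝ) ≤ T := Nat.cast_nonneg T
    refine abs_le.2 ⟨le_max_of_le_right (le_min ?_ (neg_abs_le _)), max_le ?_ ?_⟩
    · linarith [abs_nonneg (f x)]
    · linarith [abs_nonneg (f x)]
    · exact (min_le_right _ _).trans (le_abs_self _)
  have hlim : ∀ x, Filter.Tendsto (fun T => F T x) Filter.atTop (nhds (f x)) := fun x => by
    refine tendsto_const_nhds.congr' ?_
    filter_upwards [Filter.eventually_ge_atTop ⌈|f x|⌉₊] with T hT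
    have hT' : |f x| ≤ T := Nat.ceil_le.1 hT
    have := abs_le.1 hT'
    simp only [hF]
    rw [min_eq_right this.2, max_eq_right this.1]
  have l1 : Filter.Tendsto (fun T => ∫ x, F T x ∂γ) Filter.atTop (nhds (∫ x, f x ∂γ)) :=
    tendsto_integral_of_dominated_convergence (fun x => |f x|)
      (fun T => (hFT T).continuous.aestronglyMeasurable)
      (hmem.integrable one_le_two).abs
      (fun T => Filter.Eventually.of_forall fun x => hFf T x)
      (Filter.Eventually.of_forall hlim)
  have l2 : Filter.Tendsto (fun T => ∫ x, F T x ^ 2 ∂γ) Filter.atTop (nhds (∫ x, f x ^ 2 ∂γ)) :=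
    tendsto_integral_of_dominated_convergence (fun x => f x ^ 2)
      (fun T => ((hFT T).continuous.pow 2).aestronglyMeasurable)
      hmem.integrable_sq
      (fun T => Filter.Eventually.of_forall fun x => by
        rw [norm_pow, Real.norm_eq_abs, ← sq_abs (f x)]
        exact pow_le_pow_left₀ (abs_nonneg _) (hFf T x) 2)
      (Filter.Eventually.of_forall fun x => (hlim x).pow 2)
  have lV := l2.sub (l1.pow 2)
  have hb := fun T => (hFT T).variance_le_of_bounded hL hℓ hLℓ (hFb T)
  exact ⟨le_of_tendsto' lV fun T => (hb T).1, le_of_tendsto' (lV.mul_const ℓ) fun T => (hb T).2⟩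

end Gaussian

/-! ### Comparison of `ℓ^q` norms -/

section LqNorm

variable {q : ℝ≥0∞} {M : ℕ}

theorem lqNorm_nonneg (hq : 1 ≤ q) (v : Fin M → ℝ) : 0 ≤ lqNorm q v := by
  have : Fact (1 ≤ q) := ⟨hq⟩
  exact norm_nonneg _

theorem lqNorm_add_le (hq : 1 ≤ q) (v w : Fin M → ℝ) :
    lqNorm q (v + w) ≤ lqNorm q v + lqNorm q w := by
  have : Fact (1 ≤ q) := ⟨hq⟩
  exact norm_add_le (WithLp.toLp q v) (WithLp.toLp q w)

theorem lqNorm_zero (hq : 1 ≤ q) : lqNorm q (0 : Fin M → ℝ) = 0 := by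
  have : Fact (1 ≤ q) := ⟨hq⟩
  exact norm_zero (E := PiLp q fun _ : Fin M => ℝ)

theorem lqNorm_comp_equiv (hq : 1 ≤ q) (v : Fin M → ℝ) (e : Fin M ≃ Fin M) :
    lqNorm q (v ∘ e) = lqNorm q v := by
  by_cases hq' : q = ∞
  · subst hq'
    rw [lqNorm_top, lqNorm_top]
    exact e.iSup_comp (g := fun i => |v i|)
  · rw [lqNorm_of_ne_top hq hq', lqNorm_of_ne_top hq hq']
    congr 1
    exact e.sum_comp fun i => |v i| ^ q.toReal

theorem lqNorm_le_of_abs_le (hq : 1 ≤ q) {v : Fin M → ℝ} {s : ℝ} (hs : 0 ≤ s)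
    (h : ∀ i, |v i| ≤ s) : lqNorm q v ≤ (M : ℝ) ^ (q⁻¹).toReal * s := by
  -- For `q = ∞` the exponent is `0` and the factor is `1`, also when `M = 0`.
  by_cases hq' : q = ∞
  · subst hq'
    rw [lqNorm_top]
    simpa using Real.iSup_le h hs
  · rw [lqNorm_of_ne_top hq hq', ENNReal.toReal_inv]
    have hpos : 0 < q.toReal := ENNReal.toReal_pos (by positivity) hq'
    calc (∑ i, |v i| ^ q.toReal) ^ (1 / q.toReal)
      _ ≤ (∑ _i : Fin M, s ^ q.toReal) ^ (1 / q.toReal) := by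
          gcongr with i
          exact h i
      _ = _ := by
          rw [Finset.sum_const, Finset.card_univ, Fintype.card_fin, nsmul_eq_mul,
            Real.mul_rpow (by positivity) (by positivity), ← Real.rpow_mul hs,
            mul_one_div_cancel hpos.ne', Real.rpow_one, one_div]

/-- Each `|v i| ≤ r`, so `|v i|^q ≤ r^(q-2) (v i)²`. This is where `q ≥ 2` gives the Euclidean
Lipschitz constant `1`. -/
theorem lqNorm_le_of_sum_sq_le (hq : 2 ≤ q) {v : Fin M → ℝ} {r : ℝ} (hr : 0 ≤ r)
    (h : ∑ i, v i ^ 2 ≤ r ^ 2) : lqNorm q v ≤ r := by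
  have hv : ∀ i, |v i| ≤ r := fun i => by
    rw [← abs_of_nonneg hr]
    exact sq_le_sq.1 ((Finset.single_le_sum (f := fun i => v i ^ 2) (fun i _ => sq_nonneg _)
      (Finset.mem_univ i)).trans h)
  have hq1 : 1 ≤ q := le_trans (by norm_num) hq
  by_cases hq' : q = ∞
  · subst hq'
    rw [lqNorm_top]
    exact Real.iSup_le hv hr
  · rw [lqNorm_of_ne_top hq1 hq']
    have h2 : 2 ≤ q.toReal := by simpa using ENNReal.toReal_mono hq' hq
    have hsplit : ∀ t : ℝ, 0 ≤ t → t ^ q.toReal = t ^ (q.toReal - 2) * t ^ 2 := fun t ht => by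
      rw [← Real.rpow_natCast, ← Real.rpow_add_of_nonneg ht (by linarith) (by norm_num)]
      congr 1
      push_cast
      ring
    calc (∑ i, |v i| ^ q.toReal) ^ (1 / q.toReal) ≤ (r ^ q.toReal) ^ (1 / q.toReal) := by
          refine Real.rpow_le_rpow (Finset.sum_nonneg fun i _ => by positivity) ?_ (by positivity)
          calc ∑ i, |v i| ^ q.toReal ≤ ∑ i, r ^ (q.toReal - 2) * v i ^ 2 := by
                refine Finset.sum_le_sum fun i _ => ?_
                rw [hsplit _ (abs_nonneg _), sq_abs]
                exact mul_le_mul_of_nonneg_right (Real.rpow_le_rpow (abs_nonneg _) (hv i)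
                  (by linarith)) (sq_nonneg _)
            _ ≤ r ^ q.toReal := by
                rw [← Finset.mul_sum, hsplit r hr]
                exact mul_le_mul_of_nonneg_left h (by positivity)
      _ = r := by
          rw [← Real.rpow_mul hr, mul_one_div_cancel (by linarith), Real.rpow_one]

end LqNorm

/-! ### Lipschitz bounds and symmetry of the minimum -/

section MinSphere

variable {q : ℝ≥0∞} {M N : ℕ}

theorem minSphere_nonneg (hq : 1 ≤ q) (hN : 1 ≤ N) (A : Matrix (Fin M) (Fin N) ℝ) :
    0 ≤ minSphere q A := by
  obtain ⟨σ, -, hσ⟩ := (isLeast_minSphere hq hN A).1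
  rw [← hσ]
  exact lqNorm_nonneg hq _

theorem minSphere_le (hq : 1 ≤ q) (hN : 1 ≤ N) (A : Matrix (Fin M) (Fin N) ℝ)
    {σ : EuclideanSpace ℝ (Fin N)} (hσ : ‖σ‖ = 1) : minSphere q A ≤ lqNorm q (A.mulVec σ.ofLp) :=
  (isLeast_minSphere hq hN A).2 ⟨σ, by simpa using hσ, rfl⟩

theorem exists_minSphere_eq (hq : 1 ≤ q) (hN : 1 ≤ N) (A : Matrix (Fin M) (Fin N) ℝ) :
    ∃ σ : EuclideanSpace ℝ (Fin N), ‖σ‖ = 1 ∧ lqNorm q (A.mulVec σ.ofLp) = minSphere q A := by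
  obtain ⟨σ, h, hσ⟩ := (isLeast_minSphere hq hN A).1
  exact ⟨σ, by simpa using h, hσ⟩

theorem minSphere_eq_zero_of_lt (hq : 1 ≤ q) (h : M < N) (A : Matrix (Fin M) (Fin N) ℝ) :
    minSphere q A = 0 := by
  have hN : 1 ≤ N := by omega
  refine le_antisymm ?_ (minSphere_nonneg hq hN A)
  have hker : LinearMap.ker A.mulVecLin ≠ ⊥ := LinearMap.ker_ne_bot_of_finrank_lt (by simpa using h)
  obtain ⟨v, hv, hv0⟩ := Submodule.exists_mem_ne_zero_of_ne_bot hker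
  have hv' : A.mulVec v = 0 := hv
  set w : EuclideanSpace ℝ (Fin N) := WithLp.toLp 2 v with hw
  have hw0 : w ≠ 0 := by simpa [hw] using hv0
  refine (minSphere_le hq hN A (σ := ‖w‖⁻¹ • w) ?_).trans_eq ?_
  · rw [norm_smul, norm_inv, norm_norm, inv_mul_cancel₀ (norm_ne_zero_iff.2 hw0)]
  · rw [WithLp.ofLp_smul, Matrix.mulVec_smul, hw, hv', smul_zero, lqNorm_zero hq]

/-- Evaluate one matrix at the minimiser of the other and use the triangle inequality. -/
theorem abs_minSphere_sub_le (hq : 1 ≤ q) (hN : 1 ≤ N) {A B : Matrix (Fin M) (Fin N) ℝ} {c : ℝ}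
    (h : ∀ σ : EuclideanSpace ℝ (Fin N), ‖σ‖ = 1 → lqNorm q ((A - B).mulVec σ.ofLp) ≤ c)
    (h' : ∀ σ : EuclideanSpace ℝ (Fin N), ‖σ‖ = 1 → lqNorm q ((B - A).mulVec σ.ofLp) ≤ c) :
    |minSphere q A - minSphere q B| ≤ c := by
  have key : ∀ A B : Matrix (Fin M) (Fin N) ℝ, (∀ σ : EuclideanSpace ℝ (Fin N), ‖σ‖ = 1 →
      lqNorm q ((A - B).mulVec σ.ofLp) ≤ c) → minSphere q A - minSphere q B ≤ c := by
    intro A B h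
    obtain ⟨σ, hσ, hσB⟩ := exists_minSphere_eq hq hN B
    have h1 := minSphere_le hq hN A hσ
    have h2 := lqNorm_add_le hq ((A - B).mulVec σ.ofLp) (B.mulVec σ.ofLp)
    rw [← Matrix.add_mulVec, sub_add_cancel] at h2
    linarith [h σ hσ]
  have := key A B h
  have := key B A h'
  exact abs_le.2 ⟨by linarith, by linarith⟩

theorem minSphere_submatrix (hq : 1 ≤ q) (hN : 1 ≤ N) (A : Matrix (Fin M) (Fin N) ℝ)
    (e₁ : Fin M ≃ Fin M) (e₂ : Fin N ≃ Fin N) : minSphere q (A.submatrix e₁ e₂) = minSphere q A := by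
  have key : ∀ (A : Matrix (Fin M) (Fin N) ℝ) (e₁ : Fin M ≃ Fin M) (e₂ : Fin N ≃ Fin N),
      minSphere q (A.submatrix e₁ e₂) ≤ minSphere q A := by
    intro A e₁ e₂
    obtain ⟨σ, hσ, hσA⟩ := exists_minSphere_eq hq hN A
    set T := LinearIsometryEquiv.piLpCongrLeft 2 ℝ ℝ e₂.symm
    have hT : (T σ).ofLp = σ.ofLp ∘ e₂ := by
      ext i
      simp [T, LinearIsometryEquiv.piLpCongrLeft_apply]
    refine (minSphere_le hq hN _ (σ := T σ) (by rw [T.norm_map, hσ])).trans_eq ?_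
    rw [hT, Matrix.submatrix_mulVec_equiv, Function.comp_assoc, Equiv.self_comp_symm,
      Function.comp_id, lqNorm_comp_equiv hq, hσA]
  refine le_antisymm (key A e₁ e₂) ?_
  have := key (A.submatrix e₁ e₂) e₁.symm e₂.symm
  simpa [Matrix.submatrix_submatrix] using this

theorem sum_sq_mulVec_le (D : Matrix (Fin M) (Fin N) ℝ) {σ : EuclideanSpace ℝ (Fin N)}
    (hσ : ‖σ‖ = 1) : ∑ i, D.mulVec σ.ofLp i ^ 2 ≤ ∑ p : Fin M × Fin N, D p.1 p.2 ^ 2 := by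
  rw [Fintype.sum_prod_type]
  refine Finset.sum_le_sum fun i _ => ?_
  have h := Finset.sum_mul_sq_le_sq_mul_sq Finset.univ (fun j => D i j) σ.ofLp
  rwa [← EuclideanSpace.real_norm_sq_eq σ, hσ, one_pow, mul_one] at h

theorem abs_mulVec_le (D : Matrix (Fin M) (Fin N) ℝ) {σ : EuclideanSpace ℝ (Fin N)}
    (hσ : ‖σ‖ = 1) {s : ℝ} (hs : ∀ i j, |D i j| ≤ s) (i : Fin M) :
    |D.mulVec σ.ofLp i| ≤ √N * s := by
  rcases Nat.eq_zero_or_pos N with rfl | hN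
  · simp [Matrix.mulVec, dotProduct]
  have hs0 : 0 ≤ s := (abs_nonneg _).trans (hs i ⟨0, hN⟩)
  refine Real.abs_le_sqrt ?_ |>.trans_eq (Real.sqrt_sq (by positivity))
  have h := Finset.sum_mul_sq_le_sq_mul_sq Finset.univ (fun j => D i j) σ.ofLp
  rw [← EuclideanSpace.real_norm_sq_eq σ, hσ, one_pow, mul_one] at h
  refine h.trans ?_
  rw [mul_pow, Real.sq_sqrt (Nat.cast_nonneg N)]
  refine (Finset.sum_le_sum (g := fun _ => s ^ 2) fun j _ => ?_).trans_eq (by simp)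
  rw [← sq_abs]
  exact pow_le_pow_left₀ (abs_nonneg _) (hs i j) 2

/-- The Frobenius norm dominates the operator norm, which gives the constant `1`. For entries
bounded by `s`, Cauchy-Schwarz in each row gives `√N s`, and `M` rows contribute `M^(1/q)`. Two
transpositions, of rows and of columns, carry any entry to any other. -/
theorem symmetricLipschitz_minSphere (hq : 2 ≤ q) (hN : 1 ≤ N) (hM : 1 ≤ M) :
    SymmetricLipschitz ((M : ℝ) ^ (q⁻¹).toReal * √N)
      (fun x : EuclideanSpace ℝ (Fin M × Fin N) =>
        minSphere q (Matrix.of fun i j => x (i, j))) where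
  lip := by
    have key : ∀ (x y : EuclideanSpace ℝ (Fin M × Fin N)) (σ : EuclideanSpace ℝ (Fin N)), ‖σ‖ = 1 →
        lqNorm q (((Matrix.of fun i j => x (i, j)) - (Matrix.of fun i j => y (i, j))).mulVec σ.ofLp)
          ≤ ‖x - y‖ := fun x y σ hσ =>
      lqNorm_le_of_sum_sq_le hq (norm_nonneg _) ((sum_sq_mulVec_le _ hσ).trans_eq (by
        rw [EuclideanSpace.real_norm_sq_eq]; rfl))
    intro x y
    exact abs_minSphere_sub_le (le_trans (by norm_num) hq) hN (key x y) fun σ hσ => by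
      rw [norm_sub_rev]; exact key y x σ hσ
  lip_sup := by
    have hq1 : 1 ≤ q := le_trans (by norm_num) hq
    have key : ∀ (x y : EuclideanSpace ℝ (Fin M × Fin N)) (s : ℝ), (∀ a, |x a - y a| ≤ s) →
        ∀ σ : EuclideanSpace ℝ (Fin N), ‖σ‖ = 1 →
        lqNorm q (((Matrix.of fun i j => x (i, j)) - (Matrix.of fun i j => y (i, j))).mulVec σ.ofLp)
          ≤ (M : ℝ) ^ (q⁻¹).toReal * √N * s := fun x y s h σ hσ => by
      have hs0 : 0 ≤ s := (abs_nonneg _).trans (h (⟨0, hM⟩, ⟨0, hN⟩))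
      rw [mul_assoc]
      exact lqNorm_le_of_abs_le hq1 (by positivity) (abs_mulVec_le _ hσ fun i j => h (i, j))
    intro x y s h
    exact abs_minSphere_sub_le hq1 hN (key x y s h)
      (key y x s fun a => by rw [abs_sub_comm]; exact h a)
  symm a b := by
    refine ⟨(Equiv.swap a.1 b.1).prodCongr (Equiv.swap a.2 b.2), by
      simp [Equiv.prodCongr_apply, Prod.map], fun x => ?_⟩
    exact minSphere_submatrix (le_trans (by norm_num) hq) hN (Matrix.of fun i j => x (i, j))
      (Equiv.swap a.1 b.1) (Equiv.swap a.2 b.2)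

theorem variance_minSphere_stdGaussian_le (hq : 2 ≤ q) (hN : 1 ≤ N) (hMN : N ≤ M) :
    variance (fun x : EuclideanSpace ℝ (Fin M × Fin N) =>
        minSphere q (Matrix.of fun i j => x (i, j))) (stdGaussian _) *
      (1 + (1 / 2 - (q⁻¹).toReal) * Real.log N) ≤ 2 := by
  have hM : 1 ≤ M := hN.trans hMN
  have : Nonempty (Fin M × Fin N) := ⟨(⟨0, hM⟩, ⟨0, hN⟩)⟩
  have hM1 : (1 : ℝ) ≤ M := by exact_mod_cast hM
  have hN1 : (1 : ℝ) ≤ N := by exact_mod_cast hN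
  set s : ℝ := (q⁻¹).toReal with hs
  have hs0 : 0 ≤ s := ENNReal.toReal_nonneg
  have hs2 : s ≤ 1 / 2 := by
    have h : q⁻¹ ≤ 2⁻¹ := ENNReal.inv_le_inv.2 hq
    have := ENNReal.toReal_mono (by simp) h
    simpa [hs] using this
  have hlog : Real.log N ≤ Real.log M := Real.log_le_log (by linarith) (by exact_mod_cast hMN)
  have hlogM : 0 ≤ Real.log M := Real.log_nonneg hM1
  have hL : (1 : ℝ) ≤ (M : ℝ) ^ s * √N :=
    one_le_mul_of_one_le_of_one_le (Real.one_le_rpow hM1 hs0) (Real.one_le_sqrt.2 hN1)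
  -- With `ℓ = (1 - 2s) log M` this is an equality: both sides are `M^(2s) N`.
  have hLℓ : ((M : ℝ) ^ s * √N) ^ 2 ≤
      Fintype.card (Fin M × Fin N) * Real.exp (-((1 - 2 * s) * Real.log M)) := by
    rw [mul_pow, Real.sq_sqrt (by positivity), Fintype.card_prod, Fintype.card_fin, Fintype.card_fin,
      Nat.cast_mul, mul_right_comm]
    refine mul_le_mul_of_nonneg_right (le_of_eq ?_) (by positivity)
    have hMe : (M : ℝ) = Real.exp (Real.log M) := (Real.exp_log (by linarith)).symm
    rw [← Real.rpow_natCast, ← Real.rpow_mul (by positivity), Real.rpow_def_of_pos (by linarith)]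
    nth_rewrite 2 [hMe]
    rw [← Real.exp_add]
    congr 1
    push_cast
    ring
  obtain ⟨h1, h2⟩ := (symmetricLipschitz_minSphere hq hN hM).variance_le hL
    (mul_nonneg (by linarith) hlogM) hLℓ
  have hV := variance_nonneg (fun x : EuclideanSpace ℝ (Fin M × Fin N) =>
        minSphere q (Matrix.of fun i j => x (i, j))) (stdGaussian _)
  -- The variance `V` satisfies `V ≤ 1` and, halving the bound on `Vℓ`, `V (1/2 - s) log M ≤ 1`.
  -- Since `log N ≤ log M`, adding the two gives the constant `2`.
  have h3 := mul_le_mul_of_nonneg_left (mul_le_mul_of_nonneg_left hlog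
    (by linarith : 0 ≤ 1 / 2 - s)) hV
  linarith

end MinSphere

/-! ### Transfer to an arbitrary probability space -/

theorem map_toLp_eq_stdGaussian {ι Ω : Type*} [Fintype ι] {mΩ : MeasurableSpace Ω} {μ : Measure Ω}
    [IsProbabilityMeasure μ] {X : ι → Ω → ℝ} (hX : ∀ i, HasLaw (X i) (gaussianReal 0 1) μ)
    (hind : iIndepFun X μ) :
    μ.map (fun ω => (WithLp.toLp 2 fun i => X i ω : EuclideanSpace ℝ ι)) =
      stdGaussian (EuclideanSpace ℝ ι) := by
  have hm : ∀ i, AEMeasurable (X i) μ := fun i => (hX i).aemeasurable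
  have h := (iIndepFun_iff_map_fun_eq_pi_map hm).1 hind
  simp only [(hX _).map_eq] at h
  rw [← map_pi_eq_stdGaussian, ← h, AEMeasurable.map_map_of_aemeasurable
    (by fun_prop) (aemeasurable_pi_lambda _ hm)]
  rfl

theorem mainTheorem4 :
    ∃ C : ℝ, 0 < C ∧
      ∀ (q : ℝ≥0∞) (_ : 2 ≤ q) (α : ℝ) (_ : 0 < α)
        (N M : ℕ) (_ : 1 ≤ N) (_ : |(M : ℝ) - α * N| < 1)
        (Ω : Type*) (_ : MeasurableSpace Ω) (μ : Measure Ω) (_ : IsProbabilityMeasure μ)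
        (A : Ω → Matrix (Fin M) (Fin N) ℝ)
        (_ : ∀ i j, HasLaw (fun ω => A ω i j) (gaussianReal 0 1) μ)
        (_ : iIndepFun (fun (p : Fin M × Fin N) (ω : Ω) => A ω p.1 p.2) μ),
        MemLp (fun ω => minSphere q (A ω)) 2 μ ∧
          variance (fun ω => minSphere q (A ω)) μ
            ≤ C / (1 + (1 / 2 - (q⁻¹).toReal) * Real.log N) := by
  refine ⟨2, two_pos, fun q hq α _ N M hN _ Ω _ μ _ A hA hind => ?_⟩
  have hden : 0 < 1 + (1 / 2 - (q⁻¹).toReal) * Real.log N := by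
    have h : (q⁻¹).toReal ≤ 1 / 2 := by
      simpa using ENNReal.toReal_mono (by simp) (ENNReal.inv_le_inv.2 hq)
    have := mul_nonneg (sub_nonneg.2 h) (Real.log_natCast_nonneg N)
    linarith
  rcases lt_or_ge M N with hMN | hMN
  · have h0 : (fun ω => minSphere q (A ω)) = fun _ => 0 :=
      funext fun ω => minSphere_eq_zero_of_lt (le_trans (by norm_num) hq) hMN _
    rw [h0]
    refine ⟨memLp_const 0, ?_⟩
    rw [show (fun _ : Ω => (0 : ℝ)) = 0 from rfl, variance_zero]
    positivity
  · have hmap := map_toLp_eq_stdGaussian (X := fun (p : Fin M × Fin N) ω => A ω p.1 p.2)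
      (fun p => hA p.1 p.2) hind
    set X : Ω → EuclideanSpace ℝ (Fin M × Fin N) := fun ω => WithLp.toLp 2 fun p => A ω p.1 p.2
    have hX : AEMeasurable X μ := by
      -- `Measure.map` is `0` for a map that is not a.e. measurable, so a nonzero pushforward
      -- suffices.
      refine AEMeasurable.of_map_ne_zero ?_
      rw [hmap]
      exact IsProbabilityMeasure.ne_zero _
    have hsymm := symmetricLipschitz_minSphere hq hN (hN.trans hMN)
    set F : EuclideanSpace ℝ (Fin M × Fin N) → ℝ :=
      fun x => minSphere q (Matrix.of fun i j => x (i, j)) with hF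
    have hFX : (fun ω => minSphere q (A ω)) = F ∘ X := rfl
    have hmem := hsymm.memLp
    have hvar := variance_minSphere_stdGaussian_le hq hN hMN
    rw [← hmap] at hmem hvar
    rw [hFX]
    refine ⟨hmem.comp_of_map hX, ?_⟩
    rw [le_div_iff₀ hden, ← variance_map hsymm.continuous.measurable.aemeasurable hX]
    exact hvar
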